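/- Theorem (structural result for Player 2). Fix a horizon $T\ge 0$ and consider, for $0\le t\le T-1$, the system $$x_{t+1}=A_tx_t+B_tu_t+w_t,\qquad y_t=C_tx_t+v_t,$$ where $x_t=(x^1_t,x^2_t)$, $u_t=(u^1_t,u^2_t)$, $y_t=(y^1_t,y^2_t)$ are real vectors whose dimensions may vary with $t$, and $A_t,B_t,C_t$ are $2\times2$ block lower triangular with respect to these partitions. The vectors $x_0,(w_0,v_0),\dots,(w_{T-1},v_{T-1})$ are mutually independent with $$x_0\sim\mathcal N(0,\Sigma_{\rm init}),\qquad (w_t,v_t)\sim\mathcal N\!\left(0,\begin{bmatrix}W_t&U_t^{\top}\\U_t&V_t\end{bmatrix}\right),$$ these covariance matrices being positive semidefinite. At time $t$ Player 1 knows $\hat i_t=(y^1_{0:t-1},u^1_{0:t-1})$ and Player 2 knows $i_t=(y_{0:t-1},u_{0:t-1})$. Strategies are measurable functions $u^1_t=f^1_t(\hat i_t)$, $u^2_t=f^2_t(i_t)$, with cost $$J(f^1,f^2)=\mathbb E\Big(\sum_{t=0}^{T-1}\begin{bmatrix}x_t\\u_t\end{bmatrix}^{\top}\begin{bmatrix}Q_t&S_t\\S_t^{\top}&R_t\end{bmatrix}\begin{bmatrix}x_t\\u_t\end{bmatrix}+x_T^{\top}P_{\rm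 final}x_T\Big)\in[0,\infty],$$ where the weight matrices $\begin{bmatrix}Q_t&S_t\\S_t^{\top}&R_t\end{bmatrix}$ and $P_{\rm final}$ are positive semidefinite. Write $z_t=\mathbb E[x_t\mid i_t]$, which is taken in the closed loop under consideration. (1) For every linear strategy $u^1_t=G_t\hat i_t$ of Player 1 ($G_t$ fixed matrices) there are matrices $H^1_t,H^2_t$ ($0\le t\le T-1$) such that some strategy of Player 2 minimizes the cost among all measurable strategies of Player 2, makes $x_0,\dots,x_T$ integrable, and satisfies, almost surely, $$u^2_t=H^1_t\,\hat i_t+H^2_t\,z_t\qquad(0\le t\le T-1).$$ If moreover $R_t\succ0$ for all $0\le t\le T-1$, then, with these same matrices, every strategy of Player 2 that is optimal against $G$ makes $x_0,\dots,x_T$ integrable and has this form almost surely. (2) Define $\Sigma_0=\Sigma_{\rm init}$ and, for $0\le t\le T-1$, $$L_t=-(A_t\Sigma_tC_t^{\top}+U_t^{\top})(C_t\Sigma_tC_t^{\top}+V_t)^{-1},\qquad \Sigma_{t+1}=A_t\Sigma_tA_t^{\top}+L_t(C_t\Sigma_tA_t^{\top}+U_t)+W_t,$$ and suppose that $C_t\Sigma_tC_t^{\top}+V_t\succ0$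 for $0\le t\le T-1$ (for instance, all $V_t\succ0$). Then, for any measurable strategies of the two players (linear or not) under which $x_0,\dots,x_T$ are integrable, almost surely $$z_0=0,\qquad z_{t+1}=A_tz_t+B_tu_t-L_t(y_t-C_tz_t)\qquad(0\le t\le T-1).$$ So $z_t$ is updated by the standard Kalman filter, whose matrices do not depend on Player 1's strategy. -/

import Mathlib

open MeasureTheory ProbabilityTheory Matrix
open scoped ENNReal

/-- The data of a two-player LQG problem with horizon `T`.  All dimensions may vary with time:
player `i` has a local state of dimension `nᵢ t`, an action of dimension `mᵢ t` and a measurement of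
dimension `pᵢ t`.  Only the data at times `t < T` (and the dimension of the state at time `T`)
enter the problem. -/
structure TwoPlayerLQG where
  T : ℕ
  n₁ : ℕ → ℕ
  n₂ : ℕ → ℕ
  m₁ : ℕ → ℕ
  m₂ : ℕ → ℕ
  p₁ : ℕ → ℕ
  p₂ : ℕ → ℕ
  A₁₁ : ∀ t, Matrix (Fin (n₁ (t + 1))) (Fin (n₁ t)) ℝ
  A₂₁ : ∀ t, Matrix (Fin (n₂ (t + 1))) (Fin (n₁ t)) ℝ
  A₂₂ : ∀ t, Matrix (Fin (n₂ (t + 1))) (Fin (n₂ t)) ℝ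
  B₁₁ : ∀ t, Matrix (Fin (n₁ (t + 1))) (Fin (m₁ t)) ℝ
  B₂₁ : ∀ t, Matrix (Fin (n₂ (t + 1))) (Fin (m₁ t)) ℝ
  B₂₂ : ∀ t, Matrix (Fin (n₂ (t + 1))) (Fin (m₂ t)) ℝ
  C₁₁ : ∀ t, Matrix (Fin (p₁ t)) (Fin (n₁ t)) ℝ
  C₂₁ : ∀ t, Matrix (Fin (p₂ t)) (Fin (n₁ t)) ℝ
  C₂₂ : ∀ t, Matrix (Fin (p₂ t)) (Fin (n₂ t)) ℝ
  /-- covariance of the initial state -/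
  Sigma_init : Matrix (Fin (n₁ 0) ⊕ Fin (n₂ 0)) (Fin (n₁ 0) ⊕ Fin (n₂ 0)) ℝ
  /-- covariance of the process noise -/
  W : ∀ t, Matrix (Fin (n₁ (t + 1)) ⊕ Fin (n₂ (t + 1))) (Fin (n₁ (t + 1)) ⊕ Fin (n₂ (t + 1))) ℝ
  /-- covariance of the measurement noise -/
  V : ∀ t, Matrix (Fin (p₁ t) ⊕ Fin (p₂ t)) (Fin (p₁ t) ⊕ Fin (p₂ t)) ℝ
  /-- cross-covariance of the measurement noise with the process noise -/
  U : ∀ t, Matrix (Fin (p₁ t) ⊕ Fin (p₂ t)) (Fin (n₁ (t + 1)) ⊕ Fin (n₂ (t + 1))) ℝ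
  /-- cost weights -/
  Q : ∀ t, Matrix (Fin (n₁ t) ⊕ Fin (n₂ t)) (Fin (n₁ t) ⊕ Fin (n₂ t)) ℝ
  S : ∀ t, Matrix (Fin (n₁ t) ⊕ Fin (n₂ t)) (Fin (m₁ t) ⊕ Fin (m₂ t)) ℝ
  R : ∀ t, Matrix (Fin (m₁ t) ⊕ Fin (m₂ t)) (Fin (m₁ t) ⊕ Fin (m₂ t)) ℝ
  P_final : Matrix (Fin (n₁ T) ⊕ Fin (n₂ T)) (Fin (n₁ T) ⊕ Fin (n₂ T)) ℝ

namespace TwoPlayerLQG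

/-- Coordinates of the global state at time `t`. -/
abbrev StateIdx (M : TwoPlayerLQG) (t : ℕ) : Type := Fin (M.n₁ t) ⊕ Fin (M.n₂ t)

/-- Coordinates of the joint action at time `t`. -/
abbrev ActIdx (M : TwoPlayerLQG) (t : ℕ) : Type := Fin (M.m₁ t) ⊕ Fin (M.m₂ t)

/-- Coordinates of the joint measurement at time `t`. -/
abbrev MeasIdx (M : TwoPlayerLQG) (t : ℕ) : Type := Fin (M.p₁ t) ⊕ Fin (M.p₂ t)

/-- Coordinates of Player 1's information: `y¹_s` and `u¹_s` for `s < t`. -/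
abbrev InfoIdx1 (M : TwoPlayerLQG) (t : ℕ) : Type := Σ s : Fin t, Fin (M.p₁ s) ⊕ Fin (M.m₁ s)

/-- Coordinates of Player 2's information: `y_s` and `u_s` for `s < t`. -/
abbrev InfoIdx2 (M : TwoPlayerLQG) (t : ℕ) : Type := Σ s : Fin t, M.MeasIdx s ⊕ M.ActIdx s

/-- The part of Player 2's information that is known to Player 1. -/
def restrictInfo (M : TwoPlayerLQG) (t : ℕ) (i : M.InfoIdx2 t → ℝ) : M.InfoIdx1 t → ℝ :=
  fun k => i ⟨k.1, Sum.map Sum.inl Sum.inl k.2⟩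

/-- Block lower triangular system matrices. -/
def A (M : TwoPlayerLQG) (t : ℕ) : Matrix (M.StateIdx (t + 1)) (M.StateIdx t) ℝ :=
  fromBlocks (M.A₁₁ t) 0 (M.A₂₁ t) (M.A₂₂ t)

def B (M : TwoPlayerLQG) (t : ℕ) : Matrix (M.StateIdx (t + 1)) (M.ActIdx t) ℝ :=
  fromBlocks (M.B₁₁ t) 0 (M.B₂₁ t) (M.B₂₂ t)

def C (M : TwoPlayerLQG) (t : ℕ) : Matrix (M.MeasIdx t) (M.StateIdx t) ℝ :=
  fromBlocks (M.C₁₁ t) 0 (M.C₂₁ t) (M.C₂₂ t)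

/-- Joint covariance matrix of `(w_t, v_t)`. -/
def noiseCov (M : TwoPlayerLQG) (t : ℕ) :
    Matrix (M.StateIdx (t + 1) ⊕ M.MeasIdx t) (M.StateIdx (t + 1) ⊕ M.MeasIdx t) ℝ :=
  fromBlocks (M.W t) (M.U t)ᵀ (M.U t) (M.V t)

/-- Weight matrix of the running cost, as a quadratic form in `(x_t, u_t)`. -/
def costWeight (M : TwoPlayerLQG) (t : ℕ) :
    Matrix (M.StateIdx t ⊕ M.ActIdx t) (M.StateIdx t ⊕ M.ActIdx t) ℝ :=
  fromBlocks (M.Q t) (M.S t) (M.S t)ᵀ (M.R t)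

/-- Control laws of Player 1 (one function of Player 1's information for each time). -/
abbrev Strategy1 (M : TwoPlayerLQG) : Type :=
  ∀ t, (M.InfoIdx1 t → ℝ) → (Fin (M.m₁ t) → ℝ)

/-- Control laws of Player 2 (one function of Player 2's information for each time). -/
abbrev Strategy2 (M : TwoPlayerLQG) : Type :=
  ∀ t, (M.InfoIdx2 t → ℝ) → (Fin (M.m₂ t) → ℝ)

/-- The linear strategy `u¹_t = G_t î_t` of Player 1. -/
def linearStrategy1 (M : TwoPlayerLQG) (G : ∀ t, Matrix (Fin (M.m₁ t)) (M.InfoIdx1 t) ℝ) :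
    M.Strategy1 :=
  fun t i => G t *ᵥ i

/-- The closed-loop pair `(x_t, u_t)` for given strategies and given realizations of the initial
state and of the noises. -/
noncomputable def traj (M : TwoPlayerLQG) (f₁ : M.Strategy1) (f₂ : M.Strategy2)
    (x₀ : M.StateIdx 0 → ℝ) (w : ∀ t, M.StateIdx (t + 1) → ℝ) (v : ∀ t, M.MeasIdx t → ℝ)
    (t : ℕ) : (M.StateIdx t → ℝ) × (M.ActIdx t → ℝ) :=
  let x : M.StateIdx t → ℝ :=
    match t with
    | 0 => x₀
    | s + 1 => M.A s *ᵥ (traj M f₁ f₂ x₀ w v s).1 + M.B s *ᵥ (traj M f₁ f₂ x₀ w v s).2 + w s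
  let i : M.InfoIdx2 t → ℝ := fun k =>
    Sum.elim (M.C k.1 *ᵥ (traj M f₁ f₂ x₀ w v k.1).1 + v k.1) (traj M f₁ f₂ x₀ w v k.1).2 k.2
  (x, Sum.elim (f₁ t (M.restrictInfo t i)) (f₂ t i))
termination_by t
decreasing_by
  all_goals first
    | exact Nat.lt_succ_self _
    | exact k.1.2

section Processes

variable {Ω : Type*} (M : TwoPlayerLQG) (f₁ : M.Strategy1) (f₂ : M.Strategy2)
  (x₀ : Ω → M.StateIdx 0 → ℝ) (w : ∀ t, Ω → M.StateIdx (t + 1) → ℝ)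
  (v : ∀ t, Ω → M.MeasIdx t → ℝ)

/-- The state process `x_t` under the strategies `f₁`, `f₂`. -/
noncomputable def state (t : ℕ) (ω : Ω) : M.StateIdx t → ℝ :=
  (M.traj f₁ f₂ (x₀ ω) (fun s => w s ω) (fun s => v s ω) t).1

/-- The joint action process `u_t`. -/
noncomputable def act (t : ℕ) (ω : Ω) : M.ActIdx t → ℝ :=
  (M.traj f₁ f₂ (x₀ ω) (fun s => w s ω) (fun s => v s ω) t).2

/-- The measurement process `y_t`. -/
noncomputable def meas (t : ℕ) (ω : Ω) : M.MeasIdx t → ℝ :=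
  M.C t *ᵥ M.state f₁ f₂ x₀ w v t ω + v t ω

/-- Player 2's information `i_t = (y_{0:t-1}, u_{0:t-1})`. -/
noncomputable def info2 (t : ℕ) (ω : Ω) : M.InfoIdx2 t → ℝ :=
  fun k => Sum.elim (M.meas f₁ f₂ x₀ w v k.1 ω) (M.act f₁ f₂ x₀ w v k.1 ω) k.2

/-- Player 1's information `î_t = (y¹_{0:t-1}, u¹_{0:t-1})`. -/
noncomputable def info1 (t : ℕ) (ω : Ω) : M.InfoIdx1 t → ℝ :=
  M.restrictInfo t (M.info2 f₁ f₂ x₀ w v t ω)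

/-! The closed-loop equations. -/

theorem state_zero (ω : Ω) : M.state f₁ f₂ x₀ w v 0 ω = x₀ ω := by
  unfold state
  rw [traj.eq_def]

theorem state_succ (t : ℕ) (ω : Ω) :
    M.state f₁ f₂ x₀ w v (t + 1) ω =
      M.A t *ᵥ M.state f₁ f₂ x₀ w v t ω + M.B t *ᵥ M.act f₁ f₂ x₀ w v t ω + w t ω := by
  unfold state act
  rw [traj.eq_def]

theorem act_eq (t : ℕ) (ω : Ω) :
    M.act f₁ f₂ x₀ w v t ω =
      Sum.elim (f₁ t (M.info1 f₁ f₂ x₀ w v t ω)) (f₂ t (M.info2 f₁ f₂ x₀ w v t ω)) := by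
  unfold act
  rw [traj.eq_def]
  rfl

/-- The primitive random variables: the initial state and the noises `(w_t, v_t)`, `t < T`, are
mutually independent centred Gaussian vectors with the prescribed covariances. -/
structure IsPrimitive [MeasurableSpace Ω] (P : Measure Ω) : Prop where
  measurable_init : Measurable x₀
  measurable_w : ∀ t, Measurable (w t)
  measurable_v : ∀ t, Measurable (v t)
  law_init : HasLaw (fun ω => WithLp.toLp 2 (x₀ ω)) (multivariateGaussian 0 M.Sigma_init) P
  law_noise : ∀ t < M.T, HasLaw (fun ω => WithLp.toLp 2 (Sum.elim (w t ω) (v t ω)))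
    (multivariateGaussian 0 (M.noiseCov t)) P
  indep : iIndep (fun s : Option (Fin M.T) =>
    match s with
    | none => MeasurableSpace.comap x₀ inferInstance
    | some t => MeasurableSpace.comap (fun ω => (w t ω, v t ω)) inferInstance) P

/-- The expected quadratic cost.  The integrand is nonnegative when the weight matrices are positive
semidefinite, so this is the expectation as an element of `[0, ∞]`. -/
noncomputable def cost [MeasurableSpace Ω] (P : Measure Ω) : ℝ≥0∞ :=
  ∫⁻ ω, ENNReal.ofReal
    (∑ t ∈ Finset.range M.T,
        Sum.elim (M.state f₁ f₂ x₀ w v t ω) (M.act f₁ f₂ x₀ w v t ω) ⬝ᵥ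
          (M.costWeight t *ᵥ
            Sum.elim (M.state f₁ f₂ x₀ w v t ω) (M.act f₁ f₂ x₀ w v t ω))
      + M.state f₁ f₂ x₀ w v M.T ω ⬝ᵥ (M.P_final *ᵥ M.state f₁ f₂ x₀ w v M.T ω)) ∂P

/-- `f₂` is a best response of Player 2 to `f₁` among all measurable strategies, linear or not. -/
def IsOptimal2 [MeasurableSpace Ω] (P : Measure Ω) : Prop :=
  (∀ t, Measurable (f₂ t)) ∧
    ∀ g : M.Strategy2, (∀ t, Measurable (g t)) →
      M.cost f₁ f₂ x₀ w v P ≤ M.cost f₁ g x₀ w v P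

/-- The conditional mean `z_t = E[x_t | i_t]` of the state given Player 2's information. -/
noncomputable def condMean [MeasurableSpace Ω] (P : Measure Ω) (t : ℕ) : Ω → M.StateIdx t → ℝ :=
  P[M.state f₁ f₂ x₀ w v t |
    MeasurableSpace.comap (M.info2 f₁ f₂ x₀ w v t) inferInstance]

/-- Player 2's actions are `u²_t = H¹_t î_t + H²_t z_t` almost surely, for all `t < T`
(in a closed loop where the states are integrable, so that `z_t` makes sense). -/
def HasStructure2 [MeasurableSpace Ω] (P : Measure Ω)
    (H₁ : ∀ t, Matrix (Fin (M.m₂ t)) (M.InfoIdx1 t) ℝ)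
    (H₂ : ∀ t, Matrix (Fin (M.m₂ t)) (M.StateIdx t) ℝ) : Prop :=
  (∀ t ≤ M.T, Integrable (M.state f₁ f₂ x₀ w v t) P) ∧
    ∀ t < M.T, ∀ᵐ ω ∂P,
      f₂ t (M.info2 f₁ f₂ x₀ w v t ω) =
        H₁ t *ᵥ M.info1 f₁ f₂ x₀ w v t ω + H₂ t *ᵥ M.condMean f₁ f₂ x₀ w v P t ω

end Processes

/-- Kalman gain `L = -(AΣCᵀ + Uᵀ)(CΣCᵀ + V)⁻¹` at time `t` for the error covariance `Σ`. -/
noncomputable def gainOf (M : TwoPlayerLQG) (t : ℕ) (Sig : Matrix (M.StateIdx t) (M.StateIdx t) ℝ) :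
    Matrix (M.StateIdx (t + 1)) (M.MeasIdx t) ℝ :=
  -(M.A t * Sig * (M.C t)ᵀ + (M.U t)ᵀ) * (M.C t * Sig * (M.C t)ᵀ + M.V t)⁻¹

/-- Error covariances: `Σ_0 = Σ_init`, `Σ_{t+1} = AΣAᵀ + L(CΣAᵀ + U) + W`. -/
noncomputable def errCov (M : TwoPlayerLQG) : ∀ t, Matrix (M.StateIdx t) (M.StateIdx t) ℝ
  | 0 => M.Sigma_init
  | t + 1 => M.A t * M.errCov t * (M.A t)ᵀ +
      M.gainOf t (M.errCov t) * (M.C t * M.errCov t * (M.A t)ᵀ + M.U t) + M.W t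

/-- The Kalman gain `L_t`; it depends on the model only. -/
noncomputable def kalmanGain (M : TwoPlayerLQG) (t : ℕ) :
    Matrix (M.StateIdx (t + 1)) (M.MeasIdx t) ℝ :=
  M.gainOf t (M.errCov t)

end TwoPlayerLQG

-- Let ẑ_t be the output of the filter recursion run on Player 2's information i_t (`estimate`).
-- Player 2 knows both actions, so B_t u_t enters x_{t+1} and ẑ_{t+1} alike, and the error e_t = x_t
-- - ẑ_t (`estErr`) is a linear function of the primitive noises only: it is Gaussian whatever the
-- strategies. The normal equations for the gain make e_{t+1} uncorrelated with the innovation ν_t,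
-- hence independent of it, and by induction e_t is independent of i_t (`indepFun_estErr_info2`).
-- Therefore E[x_t | i_t] = ẑ_t, which is part (2).
--
-- For part (1), Player 1 being linear, the pair s_t = (ẑ_t, î_t) follows a linear recursion driven
-- by u²_t and by ν_t, which is centred and independent of i_t (`augInfo_succ`). The expected cost
-- is the same quadratic cost written in s_t, plus a finite constant due to the errors. Completing
-- squares backward in time (`exists_riccati`) turns it into κ + Σ_t E δ_t(u²_t - K_t s_t), with κ
-- finite and the δ_t nonnegative quadratic forms (`exists_cost_eq`). Hence u²_t = K_t s_t is
-- optimal among all measurable strategies. When R_t ≻ 0 the forms δ_t are definite, so every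
-- optimal strategy coincides with it almost surely. The two blocks of K_t are H²_t and H¹_t.
--
-- Two points need care. A competing strategy may have infinite cost, so all identities between
-- costs are additive identities in [0, ∞]. The innovation covariance may be singular in part (1),
-- so the gain there is any solution of the normal equations.

-- Nonnegative quadratic forms and completion of the square.

/-- Nonnegative quadratic forms, presented as squared norms of linear maps. -/
def IsSqForm {E : Type*} [NormedAddCommGroup E] [NormedSpace ℝ E] (q : E → ℝ) : Prop :=
  ∃ (n : ℕ) (Γ : E →L[ℝ] EuclideanSpace ℝ (Fin n)), ∀ x, q x = ‖Γ x‖ ^ 2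

namespace IsSqForm

section

variable {E F U : Type*} [NormedAddCommGroup E] [NormedSpace ℝ E] [NormedAddCommGroup F]
  [NormedSpace ℝ F] [NormedAddCommGroup U] [NormedSpace ℝ U]

theorem of_inner {H : Type*} [NormedAddCommGroup H] [InnerProductSpace ℝ H]
    [FiniteDimensional ℝ H] (Γ : E →L[ℝ] H) : IsSqForm (fun x => ‖Γ x‖ ^ 2) :=
  ⟨_, ((stdOrthonormalBasis ℝ H).repr.toContinuousLinearEquiv :
    H →L[ℝ] EuclideanSpace ℝ (Fin (Module.finrank ℝ H))) ∘L Γ, fun x => by simp⟩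

theorem comp {q : F → ℝ} (hq : IsSqForm q) (f : E →L[ℝ] F) : IsSqForm (fun x => q (f x)) := by
  obtain ⟨n, Γ, h⟩ := hq
  exact ⟨n, Γ ∘L f, fun x => by simp [h]⟩

theorem add {q r : E → ℝ} (hq : IsSqForm q) (hr : IsSqForm r) :
    IsSqForm (fun x => q x + r x) := by
  obtain ⟨n, Γ, h⟩ := hq
  obtain ⟨m, Δ, h'⟩ := hr
  have := of_inner ((WithLp.prodContinuousLinearEquiv 2 ℝ (EuclideanSpace ℝ (Fin n))
    (EuclideanSpace ℝ (Fin m))).symm.toContinuousLinearMap ∘L Γ.prod Δ)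
  convert this using 2 with x
  simp [WithLp.prod_norm_sq_eq_of_L2, h, h']

theorem zero : IsSqForm (fun _ : E => (0 : ℝ)) := ⟨0, 0, fun x => by simp⟩

open scoped MatrixOrder in
theorem of_posSemidef {ι : Type*} [Fintype ι] {S : Matrix ι ι ℝ} (hS : S.PosSemidef) :
    IsSqForm (fun x : ι → ℝ => x ⬝ᵥ S *ᵥ x) := by
  classical
  obtain ⟨B, hB⟩ := (CStarAlgebra.nonneg_iff_eq_star_mul_self (a := S)).1 hS.nonneg
  rw [star_eq_conjTranspose] at hB
  subst hB
  have := of_inner ((EuclideanSpace.equiv ι ℝ).symm.toContinuousLinearMap ∘L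
    (Matrix.mulVecLin B).toContinuousLinearMap)
  convert this using 2 with x
  rw [EuclideanSpace.real_norm_sq_eq, ← Matrix.mulVec_mulVec, Matrix.dotProduct_mulVec,
    Matrix.vecMul_conjTranspose]
  simp [dotProduct, pow_two]

theorem nonneg {q : E → ℝ} (hq : IsSqForm q) (x : E) : 0 ≤ q x := by
  obtain ⟨n, Γ, h⟩ := hq
  rw [h]; positivity

theorem map_zero {q : E → ℝ} (hq : IsSqForm q) : q 0 = 0 := by
  obtain ⟨n, Γ, h⟩ := hq
  simp [h]

theorem continuous {q : E → ℝ} (hq : IsSqForm q) : Continuous q := by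
  obtain ⟨n, Γ, h⟩ := hq
  rw [funext h]; fun_prop

theorem measurable_ofReal_comp [MeasurableSpace E] [BorelSpace E] {α : Type*} [MeasurableSpace α]
    {q : E → ℝ} (hq : IsSqForm q) {f : α → E} (hf : Measurable f) :
    Measurable fun a => ENNReal.ofReal (q (f a)) :=
  (hq.continuous.measurable.comp hf).ennreal_ofReal

/-- Completion of the square: partial minimization of a nonnegative quadratic form. -/
theorem exists_completion [FiniteDimensional ℝ E] [FiniteDimensional ℝ U] {q : E × U → ℝ}
    (hq : IsSqForm q) :
    ∃ (K : E →L[ℝ] U) (r : E → ℝ), IsSqForm r ∧ ∀ x u, q (x, u) = r x + q (0, u - K x) := by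
  obtain ⟨n, Γ, h⟩ := hq
  let S₁ : E →L[ℝ] EuclideanSpace ℝ (Fin n) := Γ ∘L ContinuousLinearMap.inl ℝ E U
  let S₂ : U →ₗ[ℝ] EuclideanSpace ℝ (Fin n) := (Γ ∘L ContinuousLinearMap.inr ℝ E U).toLinearMap
  -- The form is ‖S₁ x + S₂ u‖². Its minimum over u is the squared distance from S₁ x to the range
  -- of S₂, attained where S₂ u is minus the projection of S₁ x. A linear section g of S₂ over its
  -- range selects such a u linearly, even when S₂ is not injective.
  obtain ⟨g, hg⟩ := S₂.rangeRestrict.exists_rightInverse_of_surjective S₂.range_rangeRestrict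
  have hg' : ∀ y : LinearMap.range S₂, S₂ (g y) = y := fun y =>
    congrArg Subtype.val (LinearMap.congr_fun hg y)
  let W := LinearMap.range S₂
  let K : E →L[ℝ] U := -(g.toContinuousLinearMap ∘L W.orthogonalProjectionOnto ∘L S₁)
  refine ⟨K, fun x => ‖Wᗮ.starProjection (S₁ x)‖ ^ 2,
    of_inner (Wᗮ.starProjection ∘L S₁), fun x u => ?_⟩
  have hK : S₂ (K x) = -W.starProjection (S₁ x) := by
    simp only [K, _root_.neg_apply, map_neg, ContinuousLinearMap.comp_apply]
    exact congrArg Neg.neg (hg' _)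
  have h1 : Γ (x, u) = Wᗮ.starProjection (S₁ x) + S₂ (u - K x) := by
    have e1 : Γ (x, u) = S₁ x + S₂ u := by
      simp [S₁, S₂, ← map_add]
    have e2 := W.starProjection_add_starProjection_orthogonal (S₁ x)
    rw [e1, map_sub, hK]
    nth_rewrite 1 [← e2]
    abel
  have h2 : Γ (0, u - K x) = S₂ (u - K x) := by simp [S₂]
  rw [h, h, h1, h2, norm_add_sq_real,
    Submodule.inner_left_of_mem_orthogonal (LinearMap.mem_range_self S₂ _)
      (Submodule.starProjection_apply_mem _ _)]
  ring

end

end IsSqForm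

-- Independence and expected quadratic forms with values in [0, ∞].

section Probability

variable {Ω : Type*} [mΩ : MeasurableSpace Ω]

theorem IsSqForm.lintegral_ne_top {E : Type*} [NormedAddCommGroup E] [NormedSpace ℝ E]
    {q : E → ℝ} (hq : IsSqForm q) {P : Measure Ω} {N : Ω → E} (hN2 : MemLp N 2 P) :
    ∫⁻ ω, ENNReal.ofReal (q (N ω)) ∂P ≠ ∞ := by
  obtain ⟨n, Γ, h⟩ := hq
  simp_rw [h]
  have h2 : Integrable (fun ω => ‖Γ (N ω)‖ ^ 2) P :=
    (Γ.comp_memLp' hN2).integrable_norm_pow (by norm_num)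
  rw [← ofReal_integral_eq_lintegral_ofReal h2 (ae_of_all _ fun ω => by positivity)]
  exact ENNReal.ofReal_ne_top

theorem lintegral_ofReal_sum_add {ι : Type*} {μ : Measure Ω} (s : Finset ι) {a : ι → Ω → ℝ}
    {b : Ω → ℝ} (ha : ∀ i ∈ s, Measurable fun ω => ENNReal.ofReal (a i ω))
    (hb : Measurable fun ω => ENNReal.ofReal (b ω)) (ha0 : ∀ i ∈ s, ∀ ω, 0 ≤ a i ω)
    (hb0 : ∀ ω, 0 ≤ b ω) :
    ∫⁻ ω, ENNReal.ofReal (∑ i ∈ s, a i ω + b ω) ∂μ =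
      ∑ i ∈ s, ∫⁻ ω, ENNReal.ofReal (a i ω) ∂μ + ∫⁻ ω, ENNReal.ofReal (b ω) ∂μ := by
  rw [← lintegral_finsetSum' _ fun i hi => (ha i hi).aemeasurable, ← lintegral_add_right _ hb]
  refine lintegral_congr fun ω => ?_
  rw [ENNReal.ofReal_add (Finset.sum_nonneg fun i hi => ha0 i hi ω) (hb0 ω),
    ENNReal.ofReal_sum_of_nonneg fun i hi => ha0 i hi ω]

variable {P : Measure Ω} [IsProbabilityMeasure P]

/-- Both hypotheses together make the three σ-algebras mutually independent. The product rule is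
checked on intersections of an `m₂`-set and an `m₃`-set, a π-system generating `m₂ ⊔ m₃`. -/
theorem indep_sup_right_of_indep_sup_left {m₁ m₂ m₃ : MeasurableSpace Ω} (h₁ : m₁ ≤ mΩ)
    (h₂ : m₂ ≤ mΩ) (h₃ : m₃ ≤ mΩ) (h₁₂ : Indep m₁ m₂ P) (h₁₂₃ : Indep (m₁ ⊔ m₂) m₃ P) :
    Indep m₁ (m₂ ⊔ m₃) P := by
  let p : Set (Set Ω) := Set.image2 (· ∩ ·) {s | MeasurableSet[m₂] s} {s | MeasurableSet[m₃] s}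
  have hp : IsPiSystem p := by
    rintro _ ⟨a, ha, b, hb, rfl⟩ _ ⟨c, hc, d, hd, rfl⟩ -
    exact ⟨a ∩ c, ha.inter hc, b ∩ d, hb.inter hd, Set.inter_inter_inter_comm ..⟩
  have hgen : m₂ ⊔ m₃ = MeasurableSpace.generateFrom p := by
    apply le_antisymm
    · refine sup_le (fun s hs => ?_) (fun s hs => ?_)
      · exact MeasurableSpace.measurableSet_generateFrom ⟨s, hs, Set.univ, .univ, by simp⟩
      · exact MeasurableSpace.measurableSet_generateFrom ⟨Set.univ, .univ, s, hs, by simp⟩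
    · refine MeasurableSpace.generateFrom_le ?_
      rintro _ ⟨a, ha, b, hb, rfl⟩
      exact ((le_sup_left : m₂ ≤ m₂ ⊔ m₃) a ha).inter ((le_sup_right : m₃ ≤ m₂ ⊔ m₃) b hb)
  refine IndepSets.indep h₁ (sup_le h₂ h₃) (@MeasurableSpace.isPiSystem_measurableSet Ω m₁) hp
    (@MeasurableSpace.generateFrom_measurableSet Ω m₁).symm hgen ?_
  rw [IndepSets_iff]
  rintro s _ hs ⟨a, ha, b, hb, rfl⟩
  rw [Indep_iff] at h₁₂ h₁₂₃
  have ha' : MeasurableSet[m₁ ⊔ m₂] a := (le_sup_right : m₂ ≤ m₁ ⊔ m₂) a ha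
  have hs' : MeasurableSet[m₁ ⊔ m₂] s := (le_sup_left : m₁ ≤ m₁ ⊔ m₂) s hs
  change P (s ∩ (a ∩ b)) = P s * P (a ∩ b)
  rw [← Set.inter_assoc, h₁₂₃ _ _ (hs'.inter ha') hb, h₁₂₃ _ _ ha' hb, h₁₂ _ _ hs ha, mul_assoc]

/-- No moment of `Y` is assumed, so that strategies of infinite cost are covered. Independence
allows integrating over `N` first with `Y` frozen at y; the cross term 2⟨y, N⟩ then has mean zero.
-/
theorem lintegral_sq_norm_add {n : ℕ} {Y N : Ω → EuclideanSpace ℝ (Fin n)} (hY : Measurable Y)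
    (hN : Measurable N) (hYN : IndepFun Y N P) (hN2 : MemLp N 2 P) (hN0 : P[N] = 0) :
    ∫⁻ ω, ENNReal.ofReal (‖Y ω + N ω‖ ^ 2) ∂P =
      ∫⁻ ω, ENNReal.ofReal (‖Y ω‖ ^ 2) ∂P + ∫⁻ ω, ENNReal.ofReal (‖N ω‖ ^ 2) ∂P := by
  have hmap := (indepFun_iff_map_prod_eq_prod_map_map hY.aemeasurable hN.aemeasurable).1 hYN
  have hpt : ∀ y, ∫⁻ z, ENNReal.ofReal (‖y + z‖ ^ 2) ∂(P.map N) =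
      ENNReal.ofReal (‖y‖ ^ 2) + ∫⁻ ω, ENNReal.ofReal (‖N ω‖ ^ 2) ∂P := by
    intro y
    have hi : Integrable N P := hN2.integrable (by norm_num)
    have hi2 : Integrable (fun ω => ‖N ω‖ ^ 2) P := hN2.integrable_norm_pow (by norm_num)
    have hi3 : Integrable (fun ω => 2 * inner ℝ y (N ω)) P := (hi.const_inner y).const_mul 2
    rw [lintegral_map (by fun_prop) hN,
      ← ofReal_integral_eq_lintegral_ofReal hi2 (ae_of_all _ fun ω => by positivity)]
    simp_rw [norm_add_sq_real]
    have hi4 : Integrable (fun ω => ‖y‖ ^ 2 + 2 * inner ℝ y (N ω)) P := (integrable_const _).add hi3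
    have hi5 : Integrable (fun ω => ‖y‖ ^ 2 + 2 * inner ℝ y (N ω) + ‖N ω‖ ^ 2) P := hi4.add hi2
    rw [← ofReal_integral_eq_lintegral_ofReal hi5
        (ae_of_all _ fun ω => by
          have := norm_add_sq_real y (N ω)
          simp only [Pi.zero_apply]
          rw [← this]; positivity),
      ← ENNReal.ofReal_add (by positivity) (integral_nonneg fun ω => by positivity)]
    congr 1
    rw [integral_add hi4 hi2, integral_add (integrable_const _) hi3,
      integral_const_mul, integral_inner hi]
    simp [hN0]
  calc ∫⁻ ω, ENNReal.ofReal (‖Y ω + N ω‖ ^ 2) ∂P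
      = ∫⁻ p, ENNReal.ofReal (‖p.1 + p.2‖ ^ 2) ∂(P.map fun ω => (Y ω, N ω)) := by
        rw [lintegral_map (by fun_prop) (by fun_prop)]
    _ = ∫⁻ y, (ENNReal.ofReal (‖y‖ ^ 2) + ∫⁻ ω, ENNReal.ofReal (‖N ω‖ ^ 2) ∂P) ∂(P.map Y) := by
        have : IsProbabilityMeasure (P.map N) := Measure.isProbabilityMeasure_map hN.aemeasurable
        rw [hmap, lintegral_prod _ (by fun_prop)]
        simp_rw [hpt]
    _ = _ := by
        have : IsProbabilityMeasure (P.map Y) := Measure.isProbabilityMeasure_map hY.aemeasurable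
        rw [lintegral_add_right _ measurable_const, lintegral_map (by fun_prop) hY]
        simp

variable {E : Type*} [NormedAddCommGroup E] [NormedSpace ℝ E] [MeasurableSpace E] [BorelSpace E]
  [CompleteSpace E]

theorem IsSqForm.lintegral_add {q : E → ℝ} (hq : IsSqForm q) {Y N : Ω → E} (hY : Measurable Y)
    (hN : Measurable N) (hYN : IndepFun Y N P) (hN2 : MemLp N 2 P) (hN0 : P[N] = 0) :
    ∫⁻ ω, ENNReal.ofReal (q (Y ω + N ω)) ∂P =
      ∫⁻ ω, ENNReal.ofReal (q (Y ω)) ∂P + ∫⁻ ω, ENNReal.ofReal (q (N ω)) ∂P := by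
  obtain ⟨n, Γ, h⟩ := hq
  simp_rw [h, map_add]
  refine lintegral_sq_norm_add (Γ.measurable.comp hY) (Γ.measurable.comp hN)
    (hYN.comp Γ.measurable Γ.measurable) (Γ.comp_memLp' hN2) ?_
  have := Γ.integral_comp_comm (hN2.integrable (by norm_num))
  rw [hN0, _root_.map_zero] at this
  exact this

end Probability

-- Normal equations and one step of the Gaussian filter.

/-- If d x = 0, the form vanishes at (0, x), so by semidefiniteness the whole block matrix kills (0,
x) and b x = 0. Since ker d ⊆ ker b, the map b factors through d. This yields a filter gain even
when the innovation covariance d is singular. -/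
theorem Matrix.PosSemidef.exists_mul_eq_neg {ι κ : Type*} [Fintype ι] [Fintype κ] [DecidableEq κ]
    {a : Matrix ι ι ℝ} {b : Matrix ι κ ℝ} {c : Matrix κ ι ℝ} {d : Matrix κ κ ℝ}
    (h : (fromBlocks a b c d).PosSemidef) : ∃ L : Matrix ι κ ℝ, L * d = -b := by
  have hker : LinearMap.ker d.mulVecLin ≤ LinearMap.ker b.mulVecLin := by
    intro x hx
    simp only [LinearMap.mem_ker, mulVecLin_apply] at hx ⊢
    have h0 := (h.dotProduct_mulVec_zero_iff (Sum.elim 0 x)).1 (by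
      rw [fromBlocks_mulVec]
      simp [dotProduct, hx])
    rw [fromBlocks_mulVec] at h0
    ext i
    simpa using congrFun h0 (Sum.inl i)
  obtain ⟨g, hg⟩ := LinearMap.exists_extend
    ((LinearMap.ker d.mulVecLin).liftQ b.mulVecLin hker ∘ₗ
      d.mulVecLin.quotKerEquivRange.symm.toLinearMap)
  have hgd : ∀ x, g (d *ᵥ x) = b *ᵥ x := by
    intro x
    have h1 := LinearMap.congr_fun hg ⟨d *ᵥ x, LinearMap.mem_range_self d.mulVecLin x⟩
    have h2 : d.mulVecLin.quotKerEquivRange.symm ⟨d *ᵥ x, LinearMap.mem_range_self d.mulVecLin x⟩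
        = Submodule.Quotient.mk x := by
      rw [LinearEquiv.symm_apply_eq]; rfl
    simpa [h2] using h1
  refine ⟨-LinearMap.toMatrix' g, ?_⟩
  have h3 : g ∘ₗ Matrix.toLin' d = Matrix.toLin' b := LinearMap.ext hgd
  have h4 := congrArg LinearMap.toMatrix' h3
  rw [LinearMap.toMatrix'_comp, LinearMap.toMatrix'_toLin', LinearMap.toMatrix'_toLin'] at h4
  rw [Matrix.neg_mul, h4]

namespace ProbabilityTheory

variable {Ω : Type*} [mΩ : MeasurableSpace Ω]

/-- Matrix of the covariances of the coordinates of two random vectors. -/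
noncomputable def crossCov {ι κ : Type*} (X : Ω → ι → ℝ) (Y : Ω → κ → ℝ) (P : Measure Ω) :
    Matrix ι κ ℝ :=
  of fun i j => cov[fun ω => X ω i, fun ω => Y ω j; P]

theorem crossCov_transpose {ι κ : Type*} {P : Measure Ω} {X : Ω → ι → ℝ} {Y : Ω → κ → ℝ} :
    (crossCov X Y P)ᵀ = crossCov Y X P := by
  ext i j
  exact covariance_comm ..

section

variable {ι κ μ : Type*} [Fintype ι] [Fintype κ] {P : Measure Ω} {X X' : Ω → ι → ℝ} {Y Y' : Ω → κ → ℝ}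

theorem _root_.MeasureTheory.MemLp.apply_pi (hX : MemLp X 2 P) (i : ι) :
    MemLp (fun ω => X ω i) 2 P :=
  (ContinuousLinearMap.proj (R := ℝ) (φ := fun _ : ι => ℝ) i).comp_memLp' hX

theorem _root_.MeasureTheory.MemLp.mulVec [Fintype μ] (hX : MemLp X 2 P) (A : Matrix μ ι ℝ) :
    MemLp (fun ω => A *ᵥ X ω) 2 P :=
  A.mulVecLin.toContinuousLinearMap.comp_memLp' hX

theorem crossCov_add_left [IsProbabilityMeasure P] (hX : MemLp X 2 P) (hX' : MemLp X' 2 P) (hY : MemLp Y 2 P) :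
    crossCov (fun ω => X ω + X' ω) Y P = crossCov X Y P + crossCov X' Y P := by
  ext i j
  exact covariance_add_left (hX.apply_pi i) (hX'.apply_pi i) (hY.apply_pi j)

theorem crossCov_add_right [IsProbabilityMeasure P] (hX : MemLp X 2 P) (hY : MemLp Y 2 P) (hY' : MemLp Y' 2 P) :
    crossCov X (fun ω => Y ω + Y' ω) P = crossCov X Y P + crossCov X Y' P := by
  ext i j
  exact covariance_add_right (hX.apply_pi i) (hY.apply_pi j) (hY'.apply_pi j)

theorem crossCov_mulVec_left [IsProbabilityMeasure P] (hX : MemLp X 2 P) (hY : MemLp Y 2 P) (A : Matrix μ ι ℝ) :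
    crossCov (fun ω => A *ᵥ X ω) Y P = A * crossCov X Y P := by
  ext i j
  simp only [crossCov, of_apply, Matrix.mulVec, dotProduct, Matrix.mul_apply]
  rw [covariance_fun_sum_left (fun k => (hX.apply_pi k).const_mul _) (hY.apply_pi j)]
  simp_rw [covariance_const_mul_left]

theorem crossCov_mulVec_right [IsProbabilityMeasure P] (hX : MemLp X 2 P) (hY : MemLp Y 2 P) (B : Matrix μ κ ℝ) :
    crossCov X (fun ω => B *ᵥ Y ω) P = crossCov X Y P * Bᵀ := by
  rw [← crossCov_transpose, crossCov_mulVec_left hY hX, transpose_mul, crossCov_transpose]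

theorem IndepFun.crossCov_eq_zero [IsProbabilityMeasure P] (h : IndepFun X Y P) (hX : MemLp X 2 P) (hY : MemLp Y 2 P) :
    crossCov X Y P = 0 := by
  ext i j
  exact (h.comp (measurable_pi_apply i) (measurable_pi_apply j)).covariance_eq_zero
    (hX.apply_pi i) (hY.apply_pi j)

theorem HasGaussianLaw.indepFun_of_crossCov_eq_zero
    (h : HasGaussianLaw (fun ω => (X ω, Y ω)) P) (h0 : crossCov X Y P = 0) : IndepFun X Y P :=
  HasGaussianLaw.indepFun_of_covariance_eval (X := fun i ω => X ω i) (Y := fun i ω => Y ω i) h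
    fun i j => congrFun (congrFun h0 i) j

theorem integral_mulVec [IsProbabilityMeasure P] [Fintype μ] (hX : MemLp X 2 P) (A : Matrix μ ι ℝ) :
    ∫ ω, A *ᵥ X ω ∂P = A *ᵥ ∫ ω, X ω ∂P :=
  A.mulVecLin.toContinuousLinearMap.integral_comp_comm (hX.integrable (by norm_num))

end

/-- One step of the Gaussian filter: with a gain solving the normal equations, the next error is
independent of the innovation. -/
theorem gaussian_filter_step {ι ι' κ : Type*} [Fintype ι] [Fintype ι'] [Fintype κ]
    {P : Measure Ω} [IsProbabilityMeasure P] {e : Ω → ι → ℝ} {w : Ω → ι' → ℝ} {v : Ω → κ → ℝ}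
    (he : HasGaussianLaw e P) (hwv : HasGaussianLaw (fun ω => (w ω, v ω)) P)
    (hind : IndepFun e (fun ω => (w ω, v ω)) P)
    (he0 : P[e] = 0) (hw0 : P[w] = 0) (hv0 : P[v] = 0)
    (A : Matrix ι' ι ℝ) (C : Matrix κ ι ℝ) (L : Matrix ι' κ ℝ)
    (hL : L * (C * crossCov e e P * Cᵀ + crossCov v v P) =
      -(A * crossCov e e P * Cᵀ + crossCov w v P)) :
    HasGaussianLaw (fun ω => A *ᵥ e ω + w ω + L *ᵥ (C *ᵥ e ω + v ω)) P ∧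
    (∫ ω, (A *ᵥ e ω + w ω + L *ᵥ (C *ᵥ e ω + v ω)) ∂P) = 0 ∧
    MemLp (fun ω => C *ᵥ e ω + v ω) 2 P ∧
    (∫ ω, (C *ᵥ e ω + v ω) ∂P) = 0 ∧
    crossCov (fun ω => A *ᵥ e ω + w ω + L *ᵥ (C *ᵥ e ω + v ω))
      (fun ω => A *ᵥ e ω + w ω + L *ᵥ (C *ᵥ e ω + v ω)) P =
      A * crossCov e e P * Aᵀ + L * (C * crossCov e e P * Aᵀ + crossCov v w P) +
        crossCov w w P ∧
    IndepFun (fun ω => A *ᵥ e ω + w ω + L *ᵥ (C *ᵥ e ω + v ω)) (fun ω => C *ᵥ e ω + v ω) P := by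
  have hjoint : HasGaussianLaw (fun ω => (e ω, (w ω, v ω))) P := hind.hasGaussianLaw he hwv
  have he2 := he.memLp_two
  have hw2 := hwv.fst.memLp_two
  have hv2 := hwv.snd.memLp_two
  have hiw : IndepFun e w P := hind.comp measurable_id measurable_fst
  have hiv : IndepFun e v P := hind.comp measurable_id measurable_snd
  have hew := hiw.crossCov_eq_zero he2 hw2
  have hev := hiv.crossCov_eq_zero he2 hv2
  have hwe : crossCov w e P = 0 := by rw [← crossCov_transpose, hew, transpose_zero]
  have hve : crossCov v e P = 0 := by rw [← crossCov_transpose, hev, transpose_zero]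
  set ν : Ω → κ → ℝ := fun ω => C *ᵥ e ω + v ω with hν
  set X : Ω → ι' → ℝ := fun ω => A *ᵥ e ω + w ω with hX
  have hν2 : MemLp ν 2 P := (he2.mulVec C).add hv2
  have hX2 : MemLp X 2 P := (he2.mulVec A).add hw2
  have hLν2 := hν2.mulVec L
  have hE2 : MemLp (fun ω => X ω + L *ᵥ ν ω) 2 P := hX2.add hLν2
  have hν0 : ∫ ω, ν ω ∂P = 0 := by
    rw [hν, integral_add ((he2.mulVec C).integrable one_le_two) (hv2.integrable one_le_two), integral_mulVec he2, he0, hv0]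
    simp
  have hX0 : ∫ ω, X ω ∂P = 0 := by
    rw [hX, integral_add ((he2.mulVec A).integrable one_le_two) (hw2.integrable one_le_two), integral_mulVec he2, he0, hw0]
    simp
  have cXν : crossCov X ν P = A * crossCov e e P * Cᵀ + crossCov w v P := by
    rw [hX, crossCov_add_left (he2.mulVec A) hw2 hν2, crossCov_mulVec_left he2 hν2, hν,
      crossCov_add_right he2 (he2.mulVec C) hv2, crossCov_add_right hw2 (he2.mulVec C) hv2,
      crossCov_mulVec_right he2 he2, crossCov_mulVec_right hw2 he2, hev, hwe]
    simp [Matrix.mul_assoc]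
  have cνν : crossCov ν ν P = C * crossCov e e P * Cᵀ + crossCov v v P := by
    nth_rewrite 1 [hν]
    rw [crossCov_add_left (he2.mulVec C) hv2 hν2, crossCov_mulVec_left he2 hν2, hν,
      crossCov_add_right he2 (he2.mulVec C) hv2, crossCov_add_right hv2 (he2.mulVec C) hv2,
      crossCov_mulVec_right he2 he2, crossCov_mulVec_right hv2 he2, hev, hve]
    simp [Matrix.mul_assoc]
  have cXX : crossCov X X P = A * crossCov e e P * Aᵀ + crossCov w w P := by
    nth_rewrite 1 [hX]
    rw [crossCov_add_left (he2.mulVec A) hw2 hX2, crossCov_mulVec_left he2 hX2, hX,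
      crossCov_add_right he2 (he2.mulVec A) hw2, crossCov_add_right hw2 (he2.mulVec A) hw2,
      crossCov_mulVec_right he2 he2, crossCov_mulVec_right hw2 he2, hew, hwe]
    simp [Matrix.mul_assoc]
  have cνX : crossCov ν X P = C * crossCov e e P * Aᵀ + crossCov v w P := by
    rw [← crossCov_transpose, cXν, transpose_add, crossCov_transpose]
    simp [transpose_mul, Matrix.mul_assoc, crossCov_transpose]
  -- This is the orthogonality encoded by the normal equations; for jointly Gaussian vectors it
  -- gives independence.
  have cEν : crossCov (fun ω => X ω + L *ᵥ ν ω) ν P = 0 := by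
    rw [crossCov_add_left hX2 hLν2 hν2, crossCov_mulVec_left hν2 hν2, cXν, cνν, hL]
    simp
  let f : (ι → ℝ) × ((ι' → ℝ) × (κ → ℝ)) →ₗ[ℝ] (ι' → ℝ) × (κ → ℝ) :=
    { toFun := fun p => (A *ᵥ p.1 + p.2.1 + L *ᵥ (C *ᵥ p.1 + p.2.2), C *ᵥ p.1 + p.2.2)
      map_add' := fun p q => by
        ext <;> simp [Matrix.mulVec_add] <;> ring
      map_smul' := fun c p => by
        ext <;> simp [Matrix.mulVec_smul, Matrix.mulVec_add] }
  have hG : HasGaussianLaw (fun ω => (X ω + L *ᵥ ν ω, ν ω)) P :=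
    hjoint.map_fun f.toContinuousLinearMap
  refine ⟨hG.fst, ?_, hν2, hν0, ?_, hG.indepFun_of_crossCov_eq_zero cEν⟩
  · rw [integral_add (hX2.integrable one_le_two) (hLν2.integrable one_le_two), integral_mulVec hν2, hX0, hν0]
    simp
  -- As the new error E = X + Lν is uncorrelated with ν, cov(E, E) = cov(E, X), which explains the
  -- one-sided form of the covariance recursion.
  · rw [crossCov_add_right hE2 hX2 hLν2, crossCov_mulVec_right hE2 hν2, cEν,
      crossCov_add_left hX2 hLν2 hX2, crossCov_mulVec_left hν2 hX2, cXX, cνX]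
    simp only [Matrix.zero_mul, add_zero]
    abel

end ProbabilityTheory

theorem exists_seq_of_forall_exists {β : ℕ → Type*} (b₀ : β 0) {R : ∀ t, β t → β (t + 1) → Prop}
    (h : ∀ t b, ∃ b', R t b b') : ∃ b : ∀ t, β t, b 0 = b₀ ∧ ∀ t, R t (b t) (b (t + 1)) := by
  choose f hf using h
  exact ⟨fun t => Nat.rec b₀ f t, rfl, fun t => hf t _⟩

/-- The continuous linear map of a real matrix. -/
noncomputable def Matrix.mulVecL {ι κ : Type*} [Fintype ι] [Fintype κ] (A : Matrix ι κ ℝ) :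
    (κ → ℝ) →L[ℝ] (ι → ℝ) :=
  A.mulVecLin.toContinuousLinearMap

@[simp]
theorem Matrix.mulVecL_apply {ι κ : Type*} [Fintype ι] [Fintype κ] (A : Matrix ι κ ℝ)
    (x : κ → ℝ) : A.mulVecL x = A *ᵥ x := rfl

theorem Measurable.const_mulVec {α ι κ : Type*} [Fintype ι] [Fintype κ] {m : MeasurableSpace α}
    {f : α → κ → ℝ} (hf : Measurable f) (A : Matrix ι κ ℝ) : Measurable (fun a => A *ᵥ f a) :=
  A.mulVecL.measurable.comp hf

-- Filter gains, state estimate, strategy-free estimation error and causality of the closed loop.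

namespace TwoPlayerLQG

variable (M : TwoPlayerLQG)

/-- `L` is a sequence of filter gains with error covariances `Sig`: the gains solve the normal
equations, which need not have a unique solution. -/
structure IsFilterGain (L : ∀ t, Matrix (M.StateIdx (t + 1)) (M.MeasIdx t) ℝ)
    (Sig : ∀ t, Matrix (M.StateIdx t) (M.StateIdx t) ℝ) : Prop where
  zero : Sig 0 = M.Sigma_init
  normal : ∀ t < M.T, L t * (M.C t * Sig t * (M.C t)ᵀ + M.V t) =
    -(M.A t * Sig t * (M.C t)ᵀ + (M.U t)ᵀ)
  succ : ∀ t < M.T, Sig (t + 1) = M.A t * Sig t * (M.A t)ᵀ +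
    L t * (M.C t * Sig t * (M.A t)ᵀ + M.U t) + M.W t

theorem isFilterGain_kalmanGain
    (h : ∀ t < M.T, (M.C t * M.errCov t * (M.C t)ᵀ + M.V t).PosDef) :
    M.IsFilterGain M.kalmanGain M.errCov where
  zero := rfl
  normal t ht := by
    rw [kalmanGain, gainOf, Matrix.nonsing_inv_mul_cancel_right]
    exact (Matrix.isUnit_iff_isUnit_det _).1 (h t ht).isUnit
  succ t _ := rfl

/-- Covariance of the predicted state together with the innovation. -/
theorem posSemidef_predictionCov {t : ℕ} {S : Matrix (M.StateIdx t) (M.StateIdx t) ℝ}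
    (hS : S.PosSemidef) (hN : (M.noiseCov t).PosSemidef) :
    (fromBlocks (M.A t * S * (M.A t)ᵀ + M.W t) (M.A t * S * (M.C t)ᵀ + (M.U t)ᵀ)
      (M.C t * S * (M.A t)ᵀ + M.U t) (M.C t * S * (M.C t)ᵀ + M.V t)).PosSemidef := by
  have h1 := (hS.mul_mul_conjTranspose_same (fromRows (M.A t) (M.C t))).add hN
  convert h1 using 1
  simp [noiseCov, fromRows_mul, conjTranspose_eq_transpose_of_trivial, transpose_fromRows,
    fromBlocks_add]

/-- Semidefiniteness of the error covariance is carried along the recursion because it makes the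
next normal equation solvable. -/
theorem exists_isFilterGain (hinit : M.Sigma_init.PosSemidef)
    (hnoise : ∀ t < M.T, (M.noiseCov t).PosSemidef) : ∃ L Sig, M.IsFilterGain L Sig := by
  obtain ⟨Sig, h0, h⟩ := exists_seq_of_forall_exists
    (β := fun t => Matrix (M.StateIdx t) (M.StateIdx t) ℝ) M.Sigma_init
    (R := fun t S S' => t < M.T → S.PosSemidef → S'.PosSemidef ∧
      ∃ L : Matrix (M.StateIdx (t + 1)) (M.MeasIdx t) ℝ,
        L * (M.C t * S * (M.C t)ᵀ + M.V t) = -(M.A t * S * (M.C t)ᵀ + (M.U t)ᵀ) ∧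
        S' = M.A t * S * (M.A t)ᵀ + L * (M.C t * S * (M.A t)ᵀ + M.U t) + M.W t) (by
    intro t S
    by_cases ht : t < M.T ∧ S.PosSemidef
    swap
    · exact ⟨0, fun h1 h2 => absurd ⟨h1, h2⟩ ht⟩
    have hN := M.posSemidef_predictionCov ht.2 (hnoise t ht.1)
    obtain ⟨L, hL⟩ := hN.exists_mul_eq_neg
    refine ⟨_, fun _ _ => ⟨?_, L, hL, rfl⟩⟩
    -- The new covariance is [1 L] N [1 L]ᵀ, with N the prediction covariance; the normal equation
    -- kills the second block of [1 L] N, leaving the one-sided formula.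
    convert hN.mul_mul_conjTranspose_same (fromCols 1 L) using 1
    rw [conjTranspose_eq_transpose_of_trivial, transpose_fromCols, fromCols_mul_fromBlocks,
      fromCols_mul_fromRows, hL]
    simp only [Matrix.one_mul, transpose_one, Matrix.mul_one, add_neg_cancel, Matrix.zero_mul]
    abel)
  have hpsd : ∀ t ≤ M.T, (Sig t).PosSemidef := by
    intro t
    induction t with
    | zero => exact fun _ => h0 ▸ hinit
    | succ t ih => exact fun ht => (h t ht (ih (by omega))).1
  have hL : ∀ t, ∃ L : Matrix (M.StateIdx (t + 1)) (M.MeasIdx t) ℝ, t < M.T →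
      L * (M.C t * Sig t * (M.C t)ᵀ + M.V t) = -(M.A t * Sig t * (M.C t)ᵀ + (M.U t)ᵀ) ∧
        Sig (t + 1) = M.A t * Sig t * (M.A t)ᵀ + L * (M.C t * Sig t * (M.A t)ᵀ + M.U t)
          + M.W t := by
    intro t
    by_cases ht : t < M.T
    · obtain ⟨L, hL⟩ := (h t ht (hpsd t ht.le)).2
      exact ⟨L, fun _ => hL⟩
    · exact ⟨0, fun h => absurd h ht⟩
  choose L hL using hL
  exact ⟨L, Sig, h0, fun t ht => (hL t ht).1, fun t ht => (hL t ht).2⟩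

/-- Player 2's information at time `t`, as part of the information at time `t + 1`. -/
def prevInfo (t : ℕ) : (M.InfoIdx2 (t + 1) → ℝ) →L[ℝ] (M.InfoIdx2 t → ℝ) :=
  ContinuousLinearMap.pi fun k => ContinuousLinearMap.proj ⟨k.1.castSucc, k.2⟩

/-- The measurement at time `t`, as part of the information at time `t + 1`. -/
def lastMeas (t : ℕ) : (M.InfoIdx2 (t + 1) → ℝ) →L[ℝ] (M.MeasIdx t → ℝ) :=
  ContinuousLinearMap.pi fun k => ContinuousLinearMap.proj ⟨Fin.last t, Sum.inl k⟩

/-- The joint action at time `t`, as part of the information at time `t + 1`. -/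
def lastAct (t : ℕ) : (M.InfoIdx2 (t + 1) → ℝ) →L[ℝ] (M.ActIdx t → ℝ) :=
  ContinuousLinearMap.pi fun k => ContinuousLinearMap.proj ⟨Fin.last t, Sum.inr k⟩

/-- The state estimate computed from Player 2's information by the filter with gains `L`. -/
noncomputable def estimate (L : ∀ t, Matrix (M.StateIdx (t + 1)) (M.MeasIdx t) ℝ) :
    ∀ t, (M.InfoIdx2 t → ℝ) →L[ℝ] (M.StateIdx t → ℝ)
  | 0 => 0
  | t + 1 => (M.A t).mulVecL ∘L estimate L t ∘L M.prevInfo t + (M.B t).mulVecL ∘L M.lastAct t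
      - (L t).mulVecL ∘L (M.lastMeas t - (M.C t).mulVecL ∘L estimate L t ∘L M.prevInfo t)

section Processes

variable {Ω : Type*} (L : ∀ t, Matrix (M.StateIdx (t + 1)) (M.MeasIdx t) ℝ)
  (x₀ : Ω → M.StateIdx 0 → ℝ) (w : ∀ t, Ω → M.StateIdx (t + 1) → ℝ)
  (v : ∀ t, Ω → M.MeasIdx t → ℝ)

/-- The estimation error of the filter with gains `L`; it does not involve the strategies. -/
noncomputable def estErr : ∀ t, Ω → M.StateIdx t → ℝ
  | 0 => x₀
  | t + 1 => fun ω => M.A t *ᵥ estErr t ω + w t ω + L t *ᵥ (M.C t *ᵥ estErr t ω + v t ω)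

/-- The innovation of the filter with gains `L`. -/
noncomputable def innov (t : ℕ) (ω : Ω) : M.MeasIdx t → ℝ :=
  M.C t *ᵥ M.estErr L x₀ w v t ω + v t ω

variable (f₁ : M.Strategy1) (f₂ : M.Strategy2)

theorem estimate_info2_succ (t : ℕ) (ω : Ω) :
    M.estimate L (t + 1) (M.info2 f₁ f₂ x₀ w v (t + 1) ω) =
      M.A t *ᵥ M.estimate L t (M.info2 f₁ f₂ x₀ w v t ω) + M.B t *ᵥ M.act f₁ f₂ x₀ w v t ω
        - L t *ᵥ (M.meas f₁ f₂ x₀ w v t ω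
          - M.C t *ᵥ M.estimate L t (M.info2 f₁ f₂ x₀ w v t ω)) := rfl

/-- The terms B_t u_t cancel in the difference of the two recursions, which is why `estErr` can be
defined without reference to the strategies. -/
theorem state_eq_estimate_add_estErr (t : ℕ) (ω : Ω) :
    M.state f₁ f₂ x₀ w v t ω =
      M.estimate L t (M.info2 f₁ f₂ x₀ w v t ω) + M.estErr L x₀ w v t ω := by
  induction t with
  | zero => rw [state_zero]; simp [estimate, estErr]
  | succ t ih =>
    rw [state_succ, estimate_info2_succ, estErr, meas, ih]
    simp only [Matrix.mulVec_add, Matrix.mulVec_sub]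
    abel

theorem meas_eq_estimate_add_innov (t : ℕ) (ω : Ω) :
    M.meas f₁ f₂ x₀ w v t ω =
      M.C t *ᵥ M.estimate L t (M.info2 f₁ f₂ x₀ w v t ω) + M.innov L x₀ w v t ω := by
  rw [meas, state_eq_estimate_add_estErr M L, innov, Matrix.mulVec_add, add_assoc]

/-- The `σ`-algebra of the initial state and of the noises before time `t`. -/
@[reducible]
def noiseAlgebra : ℕ → MeasurableSpace Ω
  | 0 => MeasurableSpace.comap x₀ inferInstance
  | t + 1 => noiseAlgebra t ⊔ MeasurableSpace.comap (fun ω => (w t ω, v t ω)) inferInstance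

theorem noiseAlgebra_mono : Monotone (M.noiseAlgebra x₀ w v) :=
  monotone_nat_of_le_succ fun _ => le_sup_left

theorem measurable_noise (t : ℕ) :
    Measurable[M.noiseAlgebra x₀ w v (t + 1)] (fun ω => (w t ω, v t ω)) :=
  (comap_measurable _).mono le_sup_right le_rfl

theorem measurable_noiseAlgebra_estErr (t : ℕ) :
    Measurable[M.noiseAlgebra x₀ w v t] (M.estErr L x₀ w v t) := by
  induction t with
  | zero => exact comap_measurable _
  | succ t ih =>
    have ih' := ih.mono (M.noiseAlgebra_mono x₀ w v t.le_succ) le_rfl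
    have hn := M.measurable_noise x₀ w v t
    exact ((ih'.const_mulVec _).add hn.fst).add
      (((ih'.const_mulVec _).add hn.snd).const_mulVec _)

variable {M f₁ f₂ x₀ w v}

theorem measurable_info2_of {m : MeasurableSpace Ω} {t : ℕ}
    (hy : ∀ s < t, Measurable[m] (M.meas f₁ f₂ x₀ w v s))
    (hu : ∀ s < t, Measurable[m] (M.act f₁ f₂ x₀ w v s)) :
    Measurable[m] (M.info2 f₁ f₂ x₀ w v t) := by
  refine measurable_pi_iff.2 fun k => ?_
  obtain ⟨s, j | j⟩ := k
  · exact (measurable_pi_apply j).comp (hy s s.2)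
  · exact (measurable_pi_apply j).comp (hu s s.2)

theorem measurable_restrictInfo (M : TwoPlayerLQG) (t : ℕ) : Measurable (M.restrictInfo t) :=
  measurable_pi_iff.2 fun _ => measurable_pi_apply _

theorem measurable_act {m : MeasurableSpace Ω} {t : ℕ} (hf₁ : Measurable (f₁ t))
    (hf₂ : Measurable (f₂ t)) (h : Measurable[m] (M.info2 f₁ f₂ x₀ w v t)) :
    Measurable[m] (M.act f₁ f₂ x₀ w v t) := by
  rw [funext (M.act_eq f₁ f₂ x₀ w v t)]
  refine measurable_pi_iff.2 fun k => ?_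
  obtain j | j := k
  · exact (measurable_pi_apply j).comp (hf₁.comp ((M.measurable_restrictInfo t).comp h))
  · exact (measurable_pi_apply j).comp (hf₂.comp h)

theorem measurable_noiseAlgebra_closedLoop (hf₁ : ∀ t, Measurable (f₁ t))
    (hf₂ : ∀ t, Measurable (f₂ t)) (t : ℕ) :
    Measurable[M.noiseAlgebra x₀ w v t] (M.state f₁ f₂ x₀ w v t) ∧
    Measurable[M.noiseAlgebra x₀ w v t] (M.info2 f₁ f₂ x₀ w v t) := by
  suffices h : ∀ t, Measurable[M.noiseAlgebra x₀ w v t] (M.state f₁ f₂ x₀ w v t) ∧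
      (∀ s < t, Measurable[M.noiseAlgebra x₀ w v t] (M.meas f₁ f₂ x₀ w v s)) ∧
      (∀ s < t, Measurable[M.noiseAlgebra x₀ w v t] (M.act f₁ f₂ x₀ w v s)) from
    ⟨(h t).1, measurable_info2_of (h t).2.1 (h t).2.2⟩
  intro t
  induction t with
  | zero =>
    refine ⟨?_, by simp, by simp⟩
    rw [funext (M.state_zero f₁ f₂ x₀ w v)]
    exact comap_measurable _
  | succ t ih =>
    obtain ⟨hx, hy, hu⟩ := ih
    have hut := measurable_act (hf₁ t) (hf₂ t) (measurable_info2_of hy hu)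
    have hle := M.noiseAlgebra_mono x₀ w v t.le_succ
    have hn := M.measurable_noise x₀ w v t
    have hx' := hx.mono hle le_rfl
    have hut' := hut.mono hle le_rfl
    refine ⟨?_, fun s hs => ?_, fun s hs => ?_⟩
    · rw [funext (M.state_succ f₁ f₂ x₀ w v t)]
      exact ((hx'.const_mulVec _).add (hut'.const_mulVec _)).add hn.fst
    · obtain hs | rfl := Nat.lt_succ_iff_lt_or_eq.1 hs
      · exact (hy s hs).mono hle le_rfl
      · exact (hx'.const_mulVec _).add hn.snd
    · obtain hs | rfl := Nat.lt_succ_iff_lt_or_eq.1 hs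
      · exact (hu s hs).mono hle le_rfl
      · exact hut'

variable [mΩ : MeasurableSpace Ω] {P : Measure Ω}

namespace IsPrimitive

variable (h : M.IsPrimitive x₀ w v P)
include h

theorem measurable_noise (t : ℕ) : Measurable (fun ω => (w t ω, v t ω)) :=
  (h.measurable_w t).prodMk (h.measurable_v t)

theorem noiseAlgebra_le (t : ℕ) : M.noiseAlgebra x₀ w v t ≤ mΩ := by
  induction t with
  | zero => exact h.measurable_init.comap_le
  | succ t ih => exact sup_le ih (h.measurable_noise t).comap_le

theorem indep_noise {t : ℕ} (ht : t < M.T) :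
    Indep (M.noiseAlgebra x₀ w v t)
      (MeasurableSpace.comap (fun ω => (w t ω, v t ω)) inferInstance) P := by
  set m : Option (Fin M.T) → MeasurableSpace Ω := fun s =>
    match s with
    | none => MeasurableSpace.comap x₀ inferInstance
    | some t => MeasurableSpace.comap (fun ω => (w t ω, v t ω)) inferInstance
  have hle : ∀ s, m s ≤ mΩ := by
    rintro (_ | s)
    · exact h.measurable_init.comap_le
    · exact (h.measurable_noise s).comap_le
  -- The index `none` of the initial state satisfies the first condition vacuously, so the first set
  -- collects all primitive variables generating `noiseAlgebra` at time t.
  have hd : Disjoint {s : Option (Fin M.T) | ∀ r ∈ s, r.1 < t} {some ⟨t, ht⟩} := by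
    simp
  have hind := indep_iSup_of_disjoint hle h.indep hd
  refine indep_of_indep_of_le hind ?_ ?_
  · have : ∀ r ≤ t, M.noiseAlgebra x₀ w v r ≤
        ⨆ i ∈ {s : Option (Fin M.T) | ∀ r ∈ s, r.1 < t}, m i := by
      intro r
      induction r with
      | zero => exact fun _ => le_iSup₂_of_le none (by simp) le_rfl
      | succ r ih =>
        exact fun hr => sup_le (ih (by omega))
          (le_iSup₂_of_le (some ⟨r, by omega⟩) (by simp; omega) le_rfl)
    exact this t le_rfl
  · exact le_iSup₂_of_le (some ⟨t, ht⟩) rfl le_rfl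

end IsPrimitive

end Processes

end TwoPlayerLQG

-- Independence of the error from Player 2's information, and the conditional mean.

theorem ProbabilityTheory.HasLaw.gaussian_moments {Ω ι : Type*} [MeasurableSpace Ω] [Fintype ι]
    [DecidableEq ι] {P : Measure Ω} {X : Ω → ι → ℝ} {S : Matrix ι ι ℝ}
    (hS : S.PosSemidef)
    (h : HasLaw (fun ω => WithLp.toLp 2 (X ω)) (multivariateGaussian 0 S) P) :
    HasGaussianLaw X P ∧ P[X] = 0 ∧ crossCov X X P = S := by
  have hG : HasGaussianLaw (fun ω => WithLp.toLp 2 (X ω)) P := h.hasGaussianLaw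
  refine ⟨hG.map_equiv_fun (EuclideanSpace.equiv ι ℝ), ?_, ?_⟩
  · have h0 : ∫ ω, WithLp.toLp 2 (X ω) ∂P = 0 := by
      rw [h.integral_eq, integral_id_multivariateGaussian]
    have := (EuclideanSpace.equiv ι ℝ).toContinuousLinearMap.integral_comp_comm hG.integrable
    rw [h0, map_zero] at this
    exact this
  · ext i j
    rw [← covariance_eval_multivariateGaussian (μ := 0) hS i j]
    exact h.covariance_fun_comp (f := fun x : EuclideanSpace ℝ ι => x i)
      (g := fun x : EuclideanSpace ℝ ι => x j) (by fun_prop) (by fun_prop)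

namespace TwoPlayerLQG

variable {M : TwoPlayerLQG} {Ω : Type*} {L : ∀ t, Matrix (M.StateIdx (t + 1)) (M.MeasIdx t) ℝ}
  {Sig : ∀ t, Matrix (M.StateIdx t) (M.StateIdx t) ℝ}
  {x₀ : Ω → M.StateIdx 0 → ℝ} {w : ∀ t, Ω → M.StateIdx (t + 1) → ℝ}
  {v : ∀ t, Ω → M.MeasIdx t → ℝ} {f₁ : M.Strategy1} {f₂ : M.Strategy2}

theorem measurable_sup_innov (t : ℕ) :
    Measurable[MeasurableSpace.comap (M.estErr L x₀ w v t) inferInstance ⊔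
        MeasurableSpace.comap (fun ω => (w t ω, v t ω)) inferInstance]
      (M.innov L x₀ w v t) :=
  (((comap_measurable _).mono le_sup_left le_rfl).const_mulVec _).add
    (((comap_measurable (fun ω => (w t ω, v t ω))).mono le_sup_right le_rfl).snd)

theorem measurable_sup_estErr (t : ℕ) :
    Measurable[MeasurableSpace.comap (M.estErr L x₀ w v t) inferInstance ⊔
        MeasurableSpace.comap (fun ω => (w t ω, v t ω)) inferInstance]
      (M.estErr L x₀ w v (t + 1)) :=
  ((((comap_measurable _).mono le_sup_left le_rfl).const_mulVec _).add
    (((comap_measurable (fun ω => (w t ω, v t ω))).mono le_sup_right le_rfl).fst)).add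
    ((measurable_sup_innov t).const_mulVec _)

variable [mΩ : MeasurableSpace Ω] {P : Measure Ω}

namespace IsPrimitive

variable (h : M.IsPrimitive x₀ w v P)
include h

theorem noise_moments {t : ℕ} (ht : t < M.T) (hN : (M.noiseCov t).PosSemidef) :
    HasGaussianLaw (fun ω => (w t ω, v t ω)) P ∧ P[w t] = 0 ∧ P[v t] = 0 ∧
    crossCov (w t) (w t) P = M.W t ∧ crossCov (v t) (v t) P = M.V t ∧
    crossCov (w t) (v t) P = (M.U t)ᵀ ∧ crossCov (v t) (w t) P = M.U t := by
  obtain ⟨hG, h0, hc⟩ := (h.law_noise t ht).gaussian_moments hN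
  have hcov : ∀ i j, crossCov (fun ω => Sum.elim (w t ω) (v t ω))
      (fun ω => Sum.elim (w t ω) (v t ω)) P i j = M.noiseCov t i j := fun i j => by rw [hc]
  let pw : (M.StateIdx (t + 1) ⊕ M.MeasIdx t → ℝ) →L[ℝ] (M.StateIdx (t + 1) → ℝ) :=
    ContinuousLinearMap.pi fun k => ContinuousLinearMap.proj (Sum.inl k)
  let pv : (M.StateIdx (t + 1) ⊕ M.MeasIdx t → ℝ) →L[ℝ] (M.MeasIdx t → ℝ) :=
    ContinuousLinearMap.pi fun k => ContinuousLinearMap.proj (Sum.inr k)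
  have hw0 := pw.integral_comp_comm hG.integrable
  have hv0 := pv.integral_comp_comm hG.integrable
  rw [h0, map_zero] at hw0 hv0
  refine ⟨hG.map_fun (pw.prod pv), hw0, hv0, ?_, ?_, ?_, ?_⟩
  · ext i j; exact hcov (Sum.inl i) (Sum.inl j)
  · ext i j; exact hcov (Sum.inr i) (Sum.inr j)
  · ext i j; exact hcov (Sum.inl i) (Sum.inr j)
  · ext i j; exact hcov (Sum.inr i) (Sum.inl j)

theorem measurable_estErr (t : ℕ) : Measurable (M.estErr L x₀ w v t) :=
  (M.measurable_noiseAlgebra_estErr L x₀ w v t).mono (h.noiseAlgebra_le t) le_rfl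

theorem measurable_innov (t : ℕ) : Measurable (M.innov L x₀ w v t) :=
  ((h.measurable_estErr t).const_mulVec _).add (h.measurable_v t)

theorem measurable_info2 (hf₁ : ∀ t, Measurable (f₁ t)) (hf₂ : ∀ t, Measurable (f₂ t)) (t : ℕ) :
    Measurable (M.info2 f₁ f₂ x₀ w v t) :=
  (measurable_noiseAlgebra_closedLoop hf₁ hf₂ t).2.mono (h.noiseAlgebra_le t) le_rfl

theorem measurable_state (hf₁ : ∀ t, Measurable (f₁ t)) (hf₂ : ∀ t, Measurable (f₂ t)) (t : ℕ) :
    Measurable (M.state f₁ f₂ x₀ w v t) :=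
  (measurable_noiseAlgebra_closedLoop hf₁ hf₂ t).1.mono (h.noiseAlgebra_le t) le_rfl

theorem indepFun_estErr_noise {t : ℕ} (ht : t < M.T) :
    IndepFun (M.estErr L x₀ w v t) (fun ω => (w t ω, v t ω)) P :=
  indep_of_indep_of_le_left (h.indep_noise ht)
    (M.measurable_noiseAlgebra_estErr L x₀ w v t).comap_le

/-- Both i_t and e_t are functions of the noises before time t, so (w_t, v_t) is independent of the
pair; combined with i_t ⟂ e_t, this makes i_t independent of (e_t, w_t, v_t) jointly. -/
theorem indep_info2_estErr_sup_noise [IsProbabilityMeasure P] (hf₁ : ∀ t, Measurable (f₁ t))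
    (hf₂ : ∀ t, Measurable (f₂ t)) {t : ℕ} (ht : t < M.T)
    (hi : IndepFun (M.estErr L x₀ w v t) (M.info2 f₁ f₂ x₀ w v t) P) :
    Indep (MeasurableSpace.comap (M.info2 f₁ f₂ x₀ w v t) inferInstance)
      (MeasurableSpace.comap (M.estErr L x₀ w v t) inferInstance ⊔
        MeasurableSpace.comap (fun ω => (w t ω, v t ω)) inferInstance) P :=
  indep_sup_right_of_indep_sup_left (h.measurable_info2 hf₁ hf₂ t).comap_le
    (h.measurable_estErr t).comap_le (h.measurable_noise t).comap_le (Indep.symm hi)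
    (indep_of_indep_of_le_left (h.indep_noise ht)
      (sup_le (measurable_noiseAlgebra_closedLoop hf₁ hf₂ t).2.comap_le
        (M.measurable_noiseAlgebra_estErr L x₀ w v t).comap_le))

theorem estErr_step [IsProbabilityMeasure P]
    (hnoise : ∀ t < M.T, (M.noiseCov t).PosSemidef) (hL : M.IsFilterGain L Sig) {t : ℕ}
    (ht : t < M.T)
    (he : HasGaussianLaw (M.estErr L x₀ w v t) P ∧ P[M.estErr L x₀ w v t] = 0 ∧
      crossCov (M.estErr L x₀ w v t) (M.estErr L x₀ w v t) P = Sig t) :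
    (HasGaussianLaw (M.estErr L x₀ w v (t + 1)) P ∧ P[M.estErr L x₀ w v (t + 1)] = 0 ∧
      crossCov (M.estErr L x₀ w v (t + 1)) (M.estErr L x₀ w v (t + 1)) P = Sig (t + 1)) ∧
    MemLp (M.innov L x₀ w v t) 2 P ∧ P[M.innov L x₀ w v t] = 0 ∧
    IndepFun (M.estErr L x₀ w v (t + 1)) (M.innov L x₀ w v t) P := by
  obtain ⟨he1, he2, he3⟩ := he
  obtain ⟨hwv, hw0, hv0, hww, hvv, hwv', hvw⟩ := h.noise_moments ht (hnoise t ht)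
  obtain ⟨h1, h2, h3, h4, h5, h6⟩ := gaussian_filter_step he1 hwv
    (h.indepFun_estErr_noise ht) he2 hw0 hv0 (M.A t) (M.C t) (L t)
    (by rw [he3, hvv, hwv']; exact hL.normal t ht)
  rw [he3, hvw, hww, ← hL.succ t ht] at h5
  exact ⟨⟨h1, h2, h5⟩, h3, h4, h6⟩

variable [IsProbabilityMeasure P] (hinit : M.Sigma_init.PosSemidef)
  (hnoise : ∀ t < M.T, (M.noiseCov t).PosSemidef) (hL : M.IsFilterGain L Sig)
include hinit hnoise hL

theorem estErr_moments {t : ℕ} (ht : t ≤ M.T) :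
    HasGaussianLaw (M.estErr L x₀ w v t) P ∧ P[M.estErr L x₀ w v t] = 0 ∧
      crossCov (M.estErr L x₀ w v t) (M.estErr L x₀ w v t) P = Sig t := by
  induction t with
  | zero => rw [hL.zero]; exact h.law_init.gaussian_moments hinit
  | succ t ih => exact (h.estErr_step hnoise hL ht (ih (by omega))).1

theorem memLp_estErr {t : ℕ} (ht : t ≤ M.T) : MemLp (M.estErr L x₀ w v t) 2 P :=
  (h.estErr_moments hinit hnoise hL ht).1.memLp_two

theorem integral_estErr {t : ℕ} (ht : t ≤ M.T) : P[M.estErr L x₀ w v t] = 0 :=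
  (h.estErr_moments hinit hnoise hL ht).2.1

theorem memLp_innov {t : ℕ} (ht : t < M.T) : MemLp (M.innov L x₀ w v t) 2 P :=
  (h.estErr_step hnoise hL ht (h.estErr_moments hinit hnoise hL ht.le)).2.1

theorem integral_innov {t : ℕ} (ht : t < M.T) : P[M.innov L x₀ w v t] = 0 :=
  (h.estErr_step hnoise hL ht (h.estErr_moments hinit hnoise hL ht.le)).2.2.1

theorem indepFun_estErr_innov {t : ℕ} (ht : t < M.T) :
    IndepFun (M.estErr L x₀ w v (t + 1)) (M.innov L x₀ w v t) P :=
  (h.estErr_step hnoise hL ht (h.estErr_moments hinit hnoise hL ht.le)).2.2.2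

variable (hf₁ : ∀ t, Measurable (f₁ t)) (hf₂ : ∀ t, Measurable (f₂ t))
include hf₁ hf₂

/-- The pair (e_{t+1}, ν_t) is a function of (e_t, w_t, v_t), hence independent of i_t, and e_{t+1}
⟂ ν_t by the filter step; so e_{t+1} is independent of (ν_t, i_t). Now i_{t+1} is a function of
(ν_t, i_t): y_t = C_t ẑ_t + ν_t, and u_t is determined by i_t. Only measurability of the strategies
enters, as i_t need not be Gaussian. -/
theorem indepFun_estErr_info2 {t : ℕ} (ht : t ≤ M.T) :
    IndepFun (M.estErr L x₀ w v t) (M.info2 f₁ f₂ x₀ w v t) P := by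
  induction t with
  | zero =>
    have : M.info2 f₁ f₂ x₀ w v 0 = fun _ k => k.1.elim0 := by
      funext ω k; exact k.1.elim0
    rw [this]
    exact indepFun_const_right _ _
  | succ t ih =>
    have hN := h.indep_info2_estErr_sup_noise hf₁ hf₂ ht (ih (by omega))
    have h1 := indep_sup_right_of_indep_sup_left (h.measurable_estErr (L := L) (t + 1)).comap_le
      (h.measurable_innov (L := L) t).comap_le (h.measurable_info2 hf₁ hf₂ t).comap_le
      (h.indepFun_estErr_innov hinit hnoise hL ht)
      (indep_of_indep_of_le_left hN.symm
        (sup_le (measurable_sup_estErr t).comap_le (measurable_sup_innov t).comap_le))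
    refine indep_of_indep_of_le_right h1 (Measurable.comap_le ?_)
    set m := MeasurableSpace.comap (M.innov L x₀ w v t) inferInstance ⊔
      MeasurableSpace.comap (M.info2 f₁ f₂ x₀ w v t) inferInstance
    have hi : Measurable[m] (M.info2 f₁ f₂ x₀ w v t) :=
      (comap_measurable _).mono le_sup_right le_rfl
    have hn : Measurable[m] (M.innov L x₀ w v t) := (comap_measurable _).mono le_sup_left le_rfl
    refine measurable_info2_of (fun s hs => ?_) (fun s hs => ?_)
    · obtain hs | rfl := Nat.lt_succ_iff_lt_or_eq.1 hs
      · exact (measurable_pi_iff.2 fun j => measurable_pi_apply _ :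
          Measurable fun (i : M.InfoIdx2 t → ℝ) (j : M.MeasIdx s) => i ⟨⟨s, hs⟩, Sum.inl j⟩).comp hi
      · rw [funext (M.meas_eq_estimate_add_innov L x₀ w v f₁ f₂ s)]
        exact (((M.estimate L s).measurable.comp hi).const_mulVec _).add hn
    · obtain hs | rfl := Nat.lt_succ_iff_lt_or_eq.1 hs
      · exact (measurable_pi_iff.2 fun j => measurable_pi_apply _ :
          Measurable fun (i : M.InfoIdx2 t → ℝ) (j : M.ActIdx s) => i ⟨⟨s, hs⟩, Sum.inr j⟩).comp hi
      · exact measurable_act (hf₁ s) (hf₂ s) hi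

theorem indepFun_innov_info2 {t : ℕ} (ht : t < M.T) :
    IndepFun (M.innov L x₀ w v t) (M.info2 f₁ f₂ x₀ w v t) P :=
  indep_of_indep_of_le_left (h.indep_info2_estErr_sup_noise hf₁ hf₂ ht
    (h.indepFun_estErr_info2 hinit hnoise hL hf₁ hf₂ ht.le)).symm
    (measurable_sup_innov t).comap_le

/-- The filter computes the conditional mean, for arbitrary measurable strategies. -/
theorem condMean_ae_eq_estimate {t : ℕ} (ht : t ≤ M.T)
    (hx : Integrable (M.state f₁ f₂ x₀ w v t) P) :
    M.condMean f₁ f₂ x₀ w v P t =ᵐ[P]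
      fun ω => M.estimate L t (M.info2 f₁ f₂ x₀ w v t ω) := by
  have hle : MeasurableSpace.comap (M.info2 f₁ f₂ x₀ w v t) inferInstance ≤ mΩ :=
    (h.measurable_info2 hf₁ hf₂ t).comap_le
  have hei : Integrable (M.estErr L x₀ w v t) P :=
    (h.memLp_estErr hinit hnoise hL ht).integrable one_le_two
  -- For nonlinear strategies the estimate inherits integrability from the state, the error being
  -- square integrable.
  have hz : Integrable (fun ω => M.estimate L t (M.info2 f₁ f₂ x₀ w v t ω)) P := by
    refine (hx.sub hei).congr (ae_of_all _ fun ω => ?_)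
    simp [M.state_eq_estimate_add_estErr L x₀ w v f₁ f₂ t ω]
  have hsplit : M.state f₁ f₂ x₀ w v t =
      (fun ω => M.estimate L t (M.info2 f₁ f₂ x₀ w v t ω)) + M.estErr L x₀ w v t :=
    funext (M.state_eq_estimate_add_estErr L x₀ w v f₁ f₂ t)
  have hzm : StronglyMeasurable[MeasurableSpace.comap (M.info2 f₁ f₂ x₀ w v t) inferInstance]
      (fun ω => M.estimate L t (M.info2 f₁ f₂ x₀ w v t ω)) :=
    ((M.estimate L t).measurable.comp (comap_measurable _)).stronglyMeasurable
  have hc := condExp_indep_eq (h.measurable_estErr (L := L) t).comap_le hle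
    (comap_measurable (M.estErr L x₀ w v t)).stronglyMeasurable
    (h.indepFun_estErr_info2 hinit hnoise hL hf₁ hf₂ ht)
  rw [condMean, hsplit]
  refine (condExp_add hz hei _).trans ?_
  rw [condExp_of_stronglyMeasurable hle hzm hz]
  filter_upwards [hc] with ω hω
  rw [Pi.add_apply, hω, h.integral_estErr hinit hnoise hL ht, add_zero]

theorem kalman_filter (hx : ∀ t ≤ M.T, Integrable (M.state f₁ f₂ x₀ w v t) P) :
    (∀ᵐ ω ∂P, M.condMean f₁ f₂ x₀ w v P 0 ω = 0) ∧
    ∀ t < M.T, ∀ᵐ ω ∂P, M.condMean f₁ f₂ x₀ w v P (t + 1) ω =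
      M.A t *ᵥ M.condMean f₁ f₂ x₀ w v P t ω + M.B t *ᵥ M.act f₁ f₂ x₀ w v t ω
        - L t *ᵥ (M.meas f₁ f₂ x₀ w v t ω - M.C t *ᵥ M.condMean f₁ f₂ x₀ w v P t ω) := by
  have hc := fun t ht => h.condMean_ae_eq_estimate hinit hnoise hL hf₁ hf₂ (t := t) ht (hx t ht)
  refine ⟨hc 0 (Nat.zero_le _), fun t ht => ?_⟩
  filter_upwards [hc t ht.le, hc (t + 1) ht] with ω h1 h2
  rw [h1, h2, estimate_info2_succ]

end IsPrimitive

end TwoPlayerLQG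

-- Player 2's decision problem in the augmented state (ẑ_t, î_t), and dynamic programming.

/-- Backward recursion from a prescribed value at T. Entries after T are irrelevant fillers, whence
the nonemptiness assumption. -/
theorem exists_backward_seq {β : ℕ → Type*} (R : ∀ t, β t → β (t + 1) → Prop)
    (h : ∀ t b', ∃ b, R t b b') (hβ : ∀ t, Nonempty (β t)) (T : ℕ) (bT : β T) :
    ∃ b : ∀ t, β t, b T = bT ∧ ∀ t < T, R t (b t) (b (t + 1)) := by
  induction T with
  | zero =>
    exact ⟨Function.update (fun t => (hβ t).some) 0 bT, by simp, by simp⟩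
  | succ T ih =>
    obtain ⟨c, hc⟩ := h T bT
    obtain ⟨b, hb, hR⟩ := ih c
    refine ⟨Function.update b (T + 1) bT, by simp, fun t ht => ?_⟩
    obtain ht | rfl := Nat.lt_succ_iff_lt_or_eq.1 ht
    · rw [Function.update_of_ne (by omega), Function.update_of_ne (by omega)]
      exact hR t ht
    · rw [Function.update_of_ne (by omega), Function.update_self, hb]
      exact hc

/-- Concatenation of two real vectors. -/
noncomputable def sumElimL (ι κ : Type*) [Fintype ι] [Fintype κ] :
    (ι → ℝ) × (κ → ℝ) →L[ℝ] (ι ⊕ κ → ℝ) :=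
  (LinearEquiv.sumArrowLequivProdArrow ι κ ℝ ℝ).symm.toLinearMap.toContinuousLinearMap

@[simp]
theorem sumElimL_apply {ι κ : Type*} [Fintype ι] [Fintype κ] (p : (ι → ℝ) × (κ → ℝ)) :
    sumElimL ι κ p = Sum.elim p.1 p.2 := rfl

theorem measurable_sumElim {α ι κ : Type*} [Fintype ι] [Fintype κ] [MeasurableSpace α]
    {f : α → ι → ℝ} {g : α → κ → ℝ} (hf : Measurable f) (hg : Measurable g) :
    Measurable fun a => Sum.elim (f a) (g a) :=
  (sumElimL ι κ).measurable.comp (hf.prodMk hg)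

/-- The first block of a real vector. -/
def inlL (ι κ : Type*) : (ι ⊕ κ → ℝ) →L[ℝ] (ι → ℝ) :=
  ContinuousLinearMap.pi fun k => ContinuousLinearMap.proj (Sum.inl k)

namespace TwoPlayerLQG

variable (M : TwoPlayerLQG)

/-- `restrictInfo` as a continuous linear map. -/
def restrictInfoL (t : ℕ) : (M.InfoIdx2 t → ℝ) →L[ℝ] (M.InfoIdx1 t → ℝ) :=
  ContinuousLinearMap.pi fun k => ContinuousLinearMap.proj ⟨k.1, Sum.map Sum.inl Sum.inl k.2⟩

@[simp]
theorem restrictInfoL_apply (t : ℕ) (i : M.InfoIdx2 t → ℝ) :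
    M.restrictInfoL t i = M.restrictInfo t i := rfl

/-- Splitting of Player 1's information at time `t + 1` into the information at time `t` and the
new observation. -/
def splitInfo1 (t : ℕ) : (M.InfoIdx1 (t + 1) → ℝ) →L[ℝ]
    (M.InfoIdx1 t → ℝ) × (Fin (M.p₁ t) ⊕ Fin (M.m₁ t) → ℝ) :=
  (ContinuousLinearMap.pi fun k => ContinuousLinearMap.proj ⟨k.1.castSucc, k.2⟩).prod
    (ContinuousLinearMap.pi fun k => ContinuousLinearMap.proj ⟨Fin.last t, k⟩)

theorem splitInfo1_injective (t : ℕ) : Function.Injective (M.splitInfo1 t) := by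
  intro i j hij
  ext ⟨s, k⟩
  have h1 := congrArg Prod.fst hij
  have h2 := congrArg Prod.snd hij
  revert k
  refine Fin.lastCases ?_ (fun s => ?_) s
  · exact fun k => congrFun h2 k
  · exact fun k => congrFun h1 ⟨s, k⟩

/-- Player 1's information at time `t + 1`, assembled from the information at time `t` and the new
observation. -/
noncomputable def snocInfo1 (t : ℕ) :
    (M.InfoIdx1 t → ℝ) × (Fin (M.p₁ t) ⊕ Fin (M.m₁ t) → ℝ) →L[ℝ] (M.InfoIdx1 (t + 1) → ℝ) :=
  ((M.splitInfo1 t).toLinearMap.exists_leftInverse_of_injective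
    (LinearMap.ker_eq_bot.2 (M.splitInfo1_injective t))).choose.toContinuousLinearMap

theorem snocInfo1_splitInfo1 (t : ℕ) (i : M.InfoIdx1 (t + 1) → ℝ) :
    M.snocInfo1 t (M.splitInfo1 t i) = i :=
  LinearMap.congr_fun ((M.splitInfo1 t).toLinearMap.exists_leftInverse_of_injective
    (LinearMap.ker_eq_bot.2 (M.splitInfo1_injective t))).choose_spec i

/-- States of Player 2's decision problem against a linear strategy of Player 1: a state vector
together with Player 1's information. -/
abbrev AugState (t : ℕ) : Type := (M.StateIdx t → ℝ) × (M.InfoIdx1 t → ℝ)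

section LinearStrategy

variable (L : ∀ t, Matrix (M.StateIdx (t + 1)) (M.MeasIdx t) ℝ)
  (G : ∀ t, Matrix (Fin (M.m₁ t)) (M.InfoIdx1 t) ℝ)

/-- The statistic of Player 2's information on which the optimal action depends. -/
noncomputable def augInfo (t : ℕ) : (M.InfoIdx2 t → ℝ) →L[ℝ] M.AugState t :=
  (M.estimate L t).prod (M.restrictInfoL t)

/-- The joint action, given Player 1's information and Player 2's action. -/
noncomputable def jointAct (t : ℕ) :
    (M.InfoIdx1 t → ℝ) × (Fin (M.m₂ t) → ℝ) →L[ℝ] (M.ActIdx t → ℝ) :=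
  sumElimL _ _ ∘L ((G t).mulVecL.prodMap (.id ℝ _))

theorem jointAct_apply (t : ℕ) (p : (M.InfoIdx1 t → ℝ) × (Fin (M.m₂ t) → ℝ)) :
    M.jointAct G t p = Sum.elim (G t *ᵥ p.1) p.2 := rfl

/-- The state together with the joint action. -/
noncomputable def stateAct (t : ℕ) :
    M.AugState t × (Fin (M.m₂ t) → ℝ) →L[ℝ] (M.StateIdx t ⊕ M.ActIdx t → ℝ) :=
  sumElimL _ _ ∘L ((.fst ℝ _ _ ∘L .fst ℝ _ _).prod
    (M.jointAct G t ∘L ((.snd ℝ _ _ ∘L .fst ℝ _ _).prod (.snd ℝ _ _))))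

theorem stateAct_apply (t : ℕ) (p : M.AugState t × (Fin (M.m₂ t) → ℝ)) :
    M.stateAct G t p = Sum.elim p.1.1 (Sum.elim (G t *ᵥ p.1.2) p.2) := rfl

/-- The running cost as a quadratic form in the augmented state and Player 2's action. -/
noncomputable def runningCost (t : ℕ) (p : M.AugState t × (Fin (M.m₂ t) → ℝ)) : ℝ :=
  M.stateAct G t p ⬝ᵥ (M.costWeight t *ᵥ M.stateAct G t p)

/-- The terminal cost as a quadratic form in the augmented state. -/
noncomputable def terminalCost (s : M.AugState M.T) : ℝ := s.1 ⬝ᵥ (M.P_final *ᵥ s.1)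

theorem isSqForm_runningCost {t : ℕ} (h : (M.costWeight t).PosSemidef) :
    IsSqForm (M.runningCost G t) :=
  (IsSqForm.of_posSemidef h).comp (M.stateAct G t)

theorem isSqForm_terminalCost (h : M.P_final.PosSemidef) : IsSqForm M.terminalCost :=
  (IsSqForm.of_posSemidef h).comp
    (ContinuousLinearMap.fst ℝ (M.StateIdx M.T → ℝ) (M.InfoIdx1 M.T → ℝ))

-- At zero augmented state Player 1's linear action vanishes, so only the block of R_t belonging to
-- Player 2 is seen.
variable {M G} in
theorem eq_zero_of_runningCost_nonpos {t : ℕ} (hR : (M.R t).PosDef) {u : Fin (M.m₂ t) → ℝ} (hu : M.runningCost G t (0, u) ≤ 0) : u = 0 := by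
  have h1 : M.runningCost G t (0, u) = Sum.elim 0 u ⬝ᵥ (M.R t *ᵥ Sum.elim 0 u) := by
    simp [runningCost, stateAct_apply, costWeight, fromBlocks_mulVec]
  by_contra hne
  have hpos := hR.dotProduct_mulVec_pos (x := Sum.elim 0 u) (fun h0 => hne (by
    funext j; exact congrFun h0 (Sum.inr j)))
  rw [star_trivial] at hpos
  linarith

/-- Update of the augmented estimate by Player 2's action and the new measurement. -/
noncomputable def augUpdate (t : ℕ) :
    (M.AugState t × (Fin (M.m₂ t) → ℝ)) × (M.MeasIdx t → ℝ) →L[ℝ] M.AugState (t + 1) :=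
  let z := ContinuousLinearMap.fst ℝ _ _ ∘L ContinuousLinearMap.fst ℝ _ _ ∘L
    ContinuousLinearMap.fst ℝ (M.AugState t × (Fin (M.m₂ t) → ℝ)) (M.MeasIdx t → ℝ)
  let i := ContinuousLinearMap.snd ℝ _ _ ∘L ContinuousLinearMap.fst ℝ _ _ ∘L
    ContinuousLinearMap.fst ℝ (M.AugState t × (Fin (M.m₂ t) → ℝ)) (M.MeasIdx t → ℝ)
  let u := ContinuousLinearMap.snd ℝ _ _ ∘L
    ContinuousLinearMap.fst ℝ (M.AugState t × (Fin (M.m₂ t) → ℝ)) (M.MeasIdx t → ℝ)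
  let y := ContinuousLinearMap.snd ℝ (M.AugState t × (Fin (M.m₂ t) → ℝ)) (M.MeasIdx t → ℝ)
  ((M.A t).mulVecL ∘L z + (M.B t).mulVecL ∘L M.jointAct G t ∘L i.prod u
      - (L t).mulVecL ∘L (y - (M.C t).mulVecL ∘L z)).prod
    (M.snocInfo1 t ∘L i.prod (sumElimL _ _ ∘L (inlL _ _ ∘L y).prod ((G t).mulVecL ∘L i)))

/-- The part of the augmented update that is driven by the innovation. -/
noncomputable def augNoise (t : ℕ) : (M.MeasIdx t → ℝ) →L[ℝ] M.AugState (t + 1) :=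
  M.augUpdate L G t ∘L .inr ℝ _ _

/-- The part of the augmented update that is known before the new measurement. -/
noncomputable def augPredict (t : ℕ) :
    M.AugState t × (Fin (M.m₂ t) → ℝ) →L[ℝ] M.AugState (t + 1) :=
  M.augUpdate L G t ∘L (.prod (.id ℝ _) ((M.C t).mulVecL ∘L .fst ℝ _ _ ∘L .fst ℝ _ _))

theorem augUpdate_eq_add (t : ℕ) (p : M.AugState t × (Fin (M.m₂ t) → ℝ)) (ν : M.MeasIdx t → ℝ) :
    M.augUpdate L G t (p, M.C t *ᵥ p.1.1 + ν) =
      M.augPredict L G t p + M.augNoise L G t ν := by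
  simp only [augPredict, augNoise, ContinuousLinearMap.comp_apply]
  rw [← map_add]
  simp

/-- Backward recursion of dynamic programming, by completion of squares. -/
theorem exists_riccati (hcost : ∀ t < M.T, (M.costWeight t).PosSemidef)
    (hfinal : M.P_final.PosSemidef) :
    ∃ (V : ∀ t, M.AugState t → ℝ) (K : ∀ t, M.AugState t →L[ℝ] (Fin (M.m₂ t) → ℝ))
      (δ : ∀ t, (Fin (M.m₂ t) → ℝ) → ℝ), V M.T = M.terminalCost ∧ (∀ t, IsSqForm (V t)) ∧
      ∀ t < M.T, IsSqForm (δ t) ∧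
        (∀ p, M.runningCost G t p + V (t + 1) (M.augPredict L G t p) =
          V t p.1 + δ t (p.2 - K t p.1)) ∧
        ∀ u, M.runningCost G t (0, u) ≤ δ t u := by
  obtain ⟨V, hVT, hV⟩ := exists_backward_seq
    (β := fun t => {V : M.AugState t → ℝ // IsSqForm V})
    (fun t V V' => t < M.T → ∃ (K : M.AugState t →L[ℝ] (Fin (M.m₂ t) → ℝ))
      (δ : (Fin (M.m₂ t) → ℝ) → ℝ), IsSqForm δ ∧
        (∀ p, M.runningCost G t p + V'.1 (M.augPredict L G t p) =
          V.1 p.1 + δ (p.2 - K p.1)) ∧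
        ∀ u, M.runningCost G t (0, u) ≤ δ u)
    (by
      rintro t ⟨V', hV'⟩
      by_cases ht : t < M.T
      · have hq := (M.isSqForm_runningCost G (hcost t ht)).add (hV'.comp (M.augPredict L G t))
        obtain ⟨K, r, hr, hK⟩ := hq.exists_completion
        -- Here δ(u) is the full form q(0, u), running cost plus next value; dropping the
        -- nonnegative value gives the lower bound used for uniqueness.
        refine ⟨⟨r, hr⟩, fun _ => ⟨K, _, hq.comp (.inr ℝ _ _), fun p => hK p.1 p.2, fun u => ?_⟩⟩
        exact le_add_of_nonneg_right (hV'.nonneg _)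
      · exact ⟨⟨_, IsSqForm.zero⟩, fun h => absurd h ht⟩)
    (fun t => ⟨⟨_, IsSqForm.zero⟩⟩) M.T ⟨_, M.isSqForm_terminalCost hfinal⟩
  have hK : ∀ t, ∃ (K : M.AugState t →L[ℝ] (Fin (M.m₂ t) → ℝ)) (δ : (Fin (M.m₂ t) → ℝ) → ℝ),
      t < M.T → IsSqForm δ ∧
        (∀ p, M.runningCost G t p + (V (t + 1)).1 (M.augPredict L G t p) =
          (V t).1 p.1 + δ (p.2 - K p.1)) ∧
        ∀ u, M.runningCost G t (0, u) ≤ δ u := by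
    intro t
    by_cases ht : t < M.T
    · obtain ⟨K, δ, h⟩ := hV t ht ht
      exact ⟨K, δ, fun _ => h⟩
    · exact ⟨0, 0, fun h => absurd h ht⟩
  choose K δ h using hK
  exact ⟨fun t => (V t).1, K, δ, congrArg Subtype.val hVT, fun t => (V t).2, h⟩

end LinearStrategy

end TwoPlayerLQG

-- Decomposition of the cost and the structure of best responses.

namespace TwoPlayerLQG

variable {M : TwoPlayerLQG} {Ω : Type*} {L : ∀ t, Matrix (M.StateIdx (t + 1)) (M.MeasIdx t) ℝ}
  {Sig : ∀ t, Matrix (M.StateIdx t) (M.StateIdx t) ℝ}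
  {x₀ : Ω → M.StateIdx 0 → ℝ} {w : ∀ t, Ω → M.StateIdx (t + 1) → ℝ}
  {v : ∀ t, Ω → M.MeasIdx t → ℝ} {f₂ : M.Strategy2}
  {G : ∀ t, Matrix (Fin (M.m₁ t)) (M.InfoIdx1 t) ℝ}

theorem measurable_linearStrategy1 (M : TwoPlayerLQG)
    (G : ∀ t, Matrix (Fin (M.m₁ t)) (M.InfoIdx1 t) ℝ) (t : ℕ) :
    Measurable (M.linearStrategy1 G t) :=
  (G t).mulVecL.measurable

theorem act_linearStrategy1 (t : ℕ) (ω : Ω) :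
    M.act (M.linearStrategy1 G) f₂ x₀ w v t ω =
      M.jointAct G t (M.info1 (M.linearStrategy1 G) f₂ x₀ w v t ω,
        f₂ t (M.info2 (M.linearStrategy1 G) f₂ x₀ w v t ω)) := by
  rw [act_eq]; rfl

/-- The new entry (y¹_t, u¹_t) of î_{t+1} is linear in (ẑ_t, î_t, ν_t), since u¹_t = G_t î_t and y_t
= C_t ẑ_t + ν_t. This is where linearity of Player 1 makes the augmented estimate a linear
controlled system. -/
theorem augInfo_succ (t : ℕ) (ω : Ω) :
    M.augInfo L (t + 1) (M.info2 (M.linearStrategy1 G) f₂ x₀ w v (t + 1) ω) =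
      M.augPredict L G t (M.augInfo L t (M.info2 (M.linearStrategy1 G) f₂ x₀ w v t ω),
        f₂ t (M.info2 (M.linearStrategy1 G) f₂ x₀ w v t ω)) +
      M.augNoise L G t (M.innov L x₀ w v t ω) := by
  rw [← augUpdate_eq_add]
  change _ = M.augUpdate L G t (_, M.C t *ᵥ M.estimate L t
    (M.info2 (M.linearStrategy1 G) f₂ x₀ w v t ω) + M.innov L x₀ w v t ω)
  rw [← meas_eq_estimate_add_innov]
  refine Prod.ext ?_ ?_
  · refine (M.estimate_info2_succ L x₀ w v (M.linearStrategy1 G) f₂ t ω).trans ?_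
    rw [act_linearStrategy1]
    rfl
  · refine (M.snocInfo1_splitInfo1 t
      (M.info1 (M.linearStrategy1 G) f₂ x₀ w v (t + 1) ω)).symm.trans ?_
    change _ = M.snocInfo1 t (M.info1 (M.linearStrategy1 G) f₂ x₀ w v t ω,
      Sum.elim (fun j => M.meas (M.linearStrategy1 G) f₂ x₀ w v t ω (Sum.inl j))
        (G t *ᵥ M.info1 (M.linearStrategy1 G) f₂ x₀ w v t ω))
    congr 1
    refine Prod.ext rfl ?_
    funext k
    obtain j | j := k
    · rfl
    · change M.act (M.linearStrategy1 G) f₂ x₀ w v t ω (Sum.inl j) = _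
      rw [act_linearStrategy1]
      rfl

/-- Separates a function of i_t from the error, which is centred and independent of i_t, so that the
expected running cost splits. -/
theorem stateAct_closedLoop (t : ℕ) (ω : Ω) :
    Sum.elim (M.state (M.linearStrategy1 G) f₂ x₀ w v t ω)
        (M.act (M.linearStrategy1 G) f₂ x₀ w v t ω) =
      M.stateAct G t ((M.augInfo L t (M.info2 (M.linearStrategy1 G) f₂ x₀ w v t ω),
        f₂ t (M.info2 (M.linearStrategy1 G) f₂ x₀ w v t ω)) +
        ((M.estErr L x₀ w v t ω, 0), 0)) := by
  rw [stateAct_apply, M.state_eq_estimate_add_estErr L, act_linearStrategy1, jointAct_apply]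
  simp [augInfo, info1]

variable [mΩ : MeasurableSpace Ω] {P : Measure Ω}

/-- Under strategies that are almost surely linear, the states are square integrable. -/
theorem IsPrimitive.memLp_state_of_linear (h : M.IsPrimitive x₀ w v P)
    (hinit : M.Sigma_init.PosSemidef) (hnoise : ∀ t < M.T, (M.noiseCov t).PosSemidef)
    (K : ∀ t, (M.InfoIdx2 t → ℝ) →L[ℝ] (Fin (M.m₂ t) → ℝ))
    (hK : ∀ t < M.T, ∀ᵐ ω ∂P, f₂ t (M.info2 (M.linearStrategy1 G) f₂ x₀ w v t ω) =
      K t (M.info2 (M.linearStrategy1 G) f₂ x₀ w v t ω)) {t : ℕ} (ht : t ≤ M.T) :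
    MemLp (M.state (M.linearStrategy1 G) f₂ x₀ w v t) 2 P := by
  suffices hs : ∀ t ≤ M.T, MemLp (M.state (M.linearStrategy1 G) f₂ x₀ w v t) 2 P ∧
      (∀ s < t, MemLp (M.meas (M.linearStrategy1 G) f₂ x₀ w v s) 2 P) ∧
      (∀ s < t, MemLp (M.act (M.linearStrategy1 G) f₂ x₀ w v s) 2 P) from (hs t ht).1
  intro t
  induction t with
  | zero =>
    refine fun _ => ⟨?_, by simp, by simp⟩
    rw [funext (M.state_zero _ f₂ x₀ w v)]
    exact (h.law_init.gaussian_moments hinit).1.memLp_two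
  | succ t ih =>
    intro ht
    obtain ⟨hx, hy, hu⟩ := ih (by omega)
    have hn := (h.noise_moments ht (hnoise t ht)).1
    have hi : MemLp (M.info2 (M.linearStrategy1 G) f₂ x₀ w v t) 2 P := by
      refine memLp_pi_iff.2 fun k => ?_
      obtain ⟨s, j | j⟩ := k
      · exact (hy s s.2).eval j
      · exact (hu s s.2).eval j
    have hut : MemLp (M.act (M.linearStrategy1 G) f₂ x₀ w v t) 2 P := by
      have := (M.jointAct G t ∘L (M.restrictInfoL t).prod (K t)).comp_memLp' hi
      refine this.ae_eq ?_
      filter_upwards [hK t ht] with ω hω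
      rw [act_linearStrategy1, hω]
      rfl
    have hAx := hx.mulVec (M.A t)
    have hBu := hut.mulVec (M.B t)
    have hCx := hx.mulVec (M.C t)
    have hw := hn.fst.memLp_two
    have hv := hn.snd.memLp_two
    refine ⟨?_, fun s hs => ?_, fun s hs => ?_⟩
    · refine ((hAx.add hBu).add hw).ae_eq (ae_of_all _ fun ω => ?_)
      exact (M.state_succ _ f₂ x₀ w v t ω).symm
    · obtain hs | rfl := Nat.lt_succ_iff_lt_or_eq.1 hs
      · exact hy s hs
      · exact hCx.add hv
    · obtain hs | rfl := Nat.lt_succ_iff_lt_or_eq.1 hs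
      · exact hu s hs
      · exact hut

variable [IsProbabilityMeasure P]

namespace IsPrimitive

section Cost

variable (h : M.IsPrimitive x₀ w v P) (hinit : M.Sigma_init.PosSemidef)
  (hnoise : ∀ t < M.T, (M.noiseCov t).PosSemidef) (hL : M.IsFilterGain L Sig)
  (hf₂ : ∀ t, Measurable (f₂ t))
include h hinit hnoise hL hf₂

theorem lintegral_runningCost (hcost : ∀ t < M.T, (M.costWeight t).PosSemidef) {t : ℕ}
    (ht : t < M.T) :
    ∫⁻ ω, ENNReal.ofReal (Sum.elim (M.state (M.linearStrategy1 G) f₂ x₀ w v t ω)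
        (M.act (M.linearStrategy1 G) f₂ x₀ w v t ω) ⬝ᵥ (M.costWeight t *ᵥ
          Sum.elim (M.state (M.linearStrategy1 G) f₂ x₀ w v t ω)
            (M.act (M.linearStrategy1 G) f₂ x₀ w v t ω))) ∂P =
      ∫⁻ ω, ENNReal.ofReal (M.runningCost G t
        (M.augInfo L t (M.info2 (M.linearStrategy1 G) f₂ x₀ w v t ω),
          f₂ t (M.info2 (M.linearStrategy1 G) f₂ x₀ w v t ω))) ∂P +
      ∫⁻ ω, ENNReal.ofReal (M.runningCost G t ((M.estErr L x₀ w v t ω, 0), 0)) ∂P := by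
  have hf₁ := M.measurable_linearStrategy1 G
  simp_rw [stateAct_closedLoop (L := L)]
  let ι : (M.StateIdx t → ℝ) →L[ℝ] M.AugState t × (Fin (M.m₂ t) → ℝ) := .inl ℝ _ _ ∘L .inl ℝ _ _
  have hφ : Measurable fun i : M.InfoIdx2 t → ℝ => (M.augInfo L t i, f₂ t i) :=
    (M.augInfo L t).measurable.prodMk (hf₂ t)
  have he2 := h.memLp_estErr hinit hnoise hL ht.le
  refine (M.isSqForm_runningCost G (hcost t ht)).lintegral_add (N := fun ω => ι _)
    (hφ.comp (h.measurable_info2 hf₁ hf₂ t)) (ι.measurable.comp (h.measurable_estErr t))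
    ((h.indepFun_estErr_info2 hinit hnoise hL hf₁ hf₂ ht.le).symm.comp hφ ι.measurable)
    (ι.comp_memLp' he2) ?_
  rw [ι.integral_comp_comm (he2.integrable one_le_two), h.integral_estErr hinit hnoise hL ht.le,
    map_zero]

theorem lintegral_terminalCost (hfinal : M.P_final.PosSemidef) :
    ∫⁻ ω, ENNReal.ofReal (M.state (M.linearStrategy1 G) f₂ x₀ w v M.T ω ⬝ᵥ
        (M.P_final *ᵥ M.state (M.linearStrategy1 G) f₂ x₀ w v M.T ω)) ∂P =
      ∫⁻ ω, ENNReal.ofReal (M.terminalCost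
        (M.augInfo L M.T (M.info2 (M.linearStrategy1 G) f₂ x₀ w v M.T ω))) ∂P +
      ∫⁻ ω, ENNReal.ofReal (M.terminalCost (M.estErr L x₀ w v M.T ω, 0)) ∂P := by
  have hf₁ := M.measurable_linearStrategy1 G
  simp_rw [M.state_eq_estimate_add_estErr L]
  exact (IsSqForm.of_posSemidef hfinal).lintegral_add
    ((M.estimate L M.T).measurable.comp (h.measurable_info2 hf₁ hf₂ M.T)) (h.measurable_estErr M.T)
    ((h.indepFun_estErr_info2 hinit hnoise hL hf₁ hf₂ le_rfl).symm.comp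
      (M.estimate L M.T).measurable measurable_id)
    (h.memLp_estErr hinit hnoise hL le_rfl) (h.integral_estErr hinit hnoise hL le_rfl)

theorem lintegral_valueFunction {t : ℕ} (ht : t < M.T) {V : M.AugState (t + 1) → ℝ}
    (hV : IsSqForm V) :
    ∫⁻ ω, ENNReal.ofReal (V (M.augInfo L (t + 1)
        (M.info2 (M.linearStrategy1 G) f₂ x₀ w v (t + 1) ω))) ∂P =
      ∫⁻ ω, ENNReal.ofReal (V (M.augPredict L G t
        (M.augInfo L t (M.info2 (M.linearStrategy1 G) f₂ x₀ w v t ω),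
          f₂ t (M.info2 (M.linearStrategy1 G) f₂ x₀ w v t ω)))) ∂P +
      ∫⁻ ω, ENNReal.ofReal (V (M.augNoise L G t (M.innov L x₀ w v t ω))) ∂P := by
  have hf₁ := M.measurable_linearStrategy1 G
  simp_rw [augInfo_succ]
  have hφ : Measurable fun i : M.InfoIdx2 t → ℝ =>
      M.augPredict L G t (M.augInfo L t i, f₂ t i) :=
    (M.augPredict L G t).measurable.comp ((M.augInfo L t).measurable.prodMk (hf₂ t))
  have hν2 := h.memLp_innov hinit hnoise hL ht
  refine hV.lintegral_add (hφ.comp (h.measurable_info2 hf₁ hf₂ t))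
    ((M.augNoise L G t).measurable.comp (h.measurable_innov t))
    ((h.indepFun_innov_info2 hinit hnoise hL hf₁ hf₂ ht).symm.comp hφ
      (M.augNoise L G t).measurable)
    ((M.augNoise L G t).comp_memLp' hν2) ?_
  rw [(M.augNoise L G t).integral_comp_comm (hν2.integrable one_le_two),
    h.integral_innov hinit hnoise hL ht, map_zero]

theorem cost_eq_sum (hcost : ∀ t < M.T, (M.costWeight t).PosSemidef)
    (hfinal : M.P_final.PosSemidef) :
    M.cost (M.linearStrategy1 G) f₂ x₀ w v P =
      ∑ t ∈ Finset.range M.T,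
        (∫⁻ ω, ENNReal.ofReal (M.runningCost G t
          (M.augInfo L t (M.info2 (M.linearStrategy1 G) f₂ x₀ w v t ω),
            f₂ t (M.info2 (M.linearStrategy1 G) f₂ x₀ w v t ω))) ∂P +
        ∫⁻ ω, ENNReal.ofReal (M.runningCost G t ((M.estErr L x₀ w v t ω, 0), 0)) ∂P) +
      (∫⁻ ω, ENNReal.ofReal (M.terminalCost
        (M.augInfo L M.T (M.info2 (M.linearStrategy1 G) f₂ x₀ w v M.T ω))) ∂P +
      ∫⁻ ω, ENNReal.ofReal (M.terminalCost (M.estErr L x₀ w v M.T ω, 0)) ∂P) := by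
  have hf₁ := M.measurable_linearStrategy1 G
  have hxm := fun t => h.measurable_state hf₁ hf₂ t
  have hum := fun t => measurable_act (hf₁ t) (hf₂ t) (h.measurable_info2 hf₁ hf₂ t)
  refine (lintegral_ofReal_sum_add _ (fun t ht => ?_) ?_ (fun t ht ω => ?_) (fun ω => ?_)).trans
    (congrArg₂ _ (Finset.sum_congr rfl fun t ht =>
      h.lintegral_runningCost hinit hnoise hL hf₂ hcost (Finset.mem_range.1 ht))
      (h.lintegral_terminalCost hinit hnoise hL hf₂ hfinal))
  · exact (IsSqForm.of_posSemidef (hcost t (Finset.mem_range.1 ht))).measurable_ofReal_comp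
      (measurable_sumElim (hxm t) (hum t))
  · exact (IsSqForm.of_posSemidef hfinal).measurable_ofReal_comp (hxm M.T)
  · exact (IsSqForm.of_posSemidef (hcost t (Finset.mem_range.1 ht))).nonneg _
  · exact (IsSqForm.of_posSemidef hfinal).nonneg _

end Cost

variable (h : M.IsPrimitive x₀ w v P) (hinit : M.Sigma_init.PosSemidef)
  (hnoise : ∀ t < M.T, (M.noiseCov t).PosSemidef) (hL : M.IsFilterGain L Sig)
include h hinit hnoise hL

/-- Player 2's cost is a constant plus a weighted squared distance from a linear feedback law. -/
theorem exists_cost_eq (hcost : ∀ t < M.T, (M.costWeight t).PosSemidef)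
    (hfinal : M.P_final.PosSemidef) (G : ∀ t, Matrix (Fin (M.m₁ t)) (M.InfoIdx1 t) ℝ) :
    ∃ (K : ∀ t, M.AugState t →L[ℝ] (Fin (M.m₂ t) → ℝ)) (δ : ∀ t, (Fin (M.m₂ t) → ℝ) → ℝ)
      (κ : ℝ≥0∞), κ ≠ ∞ ∧
      (∀ t < M.T, IsSqForm (δ t) ∧ ∀ u, M.runningCost G t (0, u) ≤ δ t u) ∧
      ∀ f₂ : M.Strategy2, (∀ t, Measurable (f₂ t)) →
        M.cost (M.linearStrategy1 G) f₂ x₀ w v P = κ + ∑ t ∈ Finset.range M.T,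
          ∫⁻ ω, ENNReal.ofReal (δ t (f₂ t (M.info2 (M.linearStrategy1 G) f₂ x₀ w v t ω) -
            K t (M.augInfo L t (M.info2 (M.linearStrategy1 G) f₂ x₀ w v t ω)))) ∂P := by
  obtain ⟨V, K, δ, hVT, hV, hK⟩ := M.exists_riccati L G hcost hfinal
  let k₁ : ℕ → ℝ≥0∞ := fun t =>
    ∫⁻ ω, ENNReal.ofReal (M.runningCost G t ((M.estErr L x₀ w v t ω, 0), 0)) ∂P
  let k₂ : ℕ → ℝ≥0∞ := fun t =>
    ∫⁻ ω, ENNReal.ofReal (V (t + 1) (M.augNoise L G t (M.innov L x₀ w v t ω))) ∂P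
  let k₃ : ℝ≥0∞ := ∫⁻ ω, ENNReal.ofReal (M.terminalCost (M.estErr L x₀ w v M.T ω, 0)) ∂P
  refine ⟨K, δ, ∑ t ∈ Finset.range M.T, (k₁ t + k₂ t) + k₃, ?_,
    fun t ht => ⟨(hK t ht).1, (hK t ht).2.2⟩, fun f₂ hf₂ => ?_⟩
  · refine ENNReal.add_ne_top.2 ⟨ENNReal.sum_ne_top.2 fun t ht => ?_, ?_⟩
    · have ht := Finset.mem_range.1 ht
      refine ENNReal.add_ne_top.2 ⟨?_, ?_⟩
      · exact ((M.isSqForm_runningCost G (hcost t ht)).comp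
          (.inl ℝ _ _ ∘L .inl ℝ _ _)).lintegral_ne_top (h.memLp_estErr hinit hnoise hL ht.le)
      · exact ((hV (t + 1)).comp (M.augNoise L G t)).lintegral_ne_top
          (h.memLp_innov hinit hnoise hL ht)
    · exact (IsSqForm.of_posSemidef hfinal).lintegral_ne_top
        (h.memLp_estErr hinit hnoise hL le_rfl)
  have hf₁ := M.measurable_linearStrategy1 G
  set i := M.info2 (M.linearStrategy1 G) f₂ x₀ w v
  have him : ∀ t, Measurable (i t) := h.measurable_info2 hf₁ hf₂
  let c : ℕ → ℝ≥0∞ := fun t =>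
    ∫⁻ ω, ENNReal.ofReal (M.runningCost G t (M.augInfo L t (i t ω), f₂ t (i t ω))) ∂P
  let J : ℕ → ℝ≥0∞ := fun t => ∫⁻ ω, ENNReal.ofReal (V t (M.augInfo L t (i t ω))) ∂P
  let d : ℕ → ℝ≥0∞ := fun t =>
    ∫⁻ ω, ENNReal.ofReal (δ t (f₂ t (i t ω) - K t (M.augInfo L t (i t ω)))) ∂P
  -- Bellman identity in expectation: the square completion applied pointwise, with the innovation
  -- contributing the strategy-free term k₂.
  have hstep : ∀ t < M.T, c t + J (t + 1) = J t + d t + k₂ t := by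
    intro t ht
    have hJ : J (t + 1) = ∫⁻ ω, ENNReal.ofReal (V (t + 1) (M.augPredict L G t
        (M.augInfo L t (i t ω), f₂ t (i t ω)))) ∂P + k₂ t :=
      h.lintegral_valueFunction hinit hnoise hL hf₂ ht (hV (t + 1))
    have hp : Measurable fun ω => (M.augInfo L t (i t ω), f₂ t (i t ω)) :=
      ((M.augInfo L t).measurable.comp (him t)).prodMk ((hf₂ t).comp (him t))
    rw [hJ, ← add_assoc]
    congr 1
    refine (lintegral_add_left ((M.isSqForm_runningCost G (hcost t ht)).measurable_ofReal_comp hp)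
      _).symm.trans (Eq.trans ?_ (lintegral_add_left
        ((hV t).measurable_ofReal_comp ((M.augInfo L t).measurable.comp (him t))) _))
    refine lintegral_congr fun ω => ?_
    rw [← ENNReal.ofReal_add ((M.isSqForm_runningCost G (hcost t ht)).nonneg _)
        ((hV (t + 1)).nonneg _),
      ← ENNReal.ofReal_add ((hV t).nonneg _) ((hK t ht).1.nonneg _), (hK t ht).2.1]
    rfl
  have hJ0 : J 0 = 0 := by
    -- At time 0 there is no information, so the augmented estimate is 0 and no initial value term
    -- remains.
    have h0 : ∀ ω, V 0 (M.augInfo L 0 (i 0 ω)) = 0 := fun ω => by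
      have : i 0 ω = 0 := funext fun k => k.1.elim0
      rw [this, map_zero, (hV 0).map_zero]
    simp [J, h0]
  -- The Bellman identities are telescoped with J n kept on the left: its value may be ∞, so it
  -- cannot be subtracted.
  have hsum : ∀ n ≤ M.T, ∑ t ∈ Finset.range n, (c t + k₁ t) + J n =
      ∑ t ∈ Finset.range n, (k₁ t + k₂ t) + ∑ t ∈ Finset.range n, d t := by
    intro n
    induction n with
    | zero => simp [hJ0]
    | succ n ih =>
      intro hn
      have e1 := ih (by omega)
      have e2 := hstep n hn
      rw [Finset.sum_range_succ, Finset.sum_range_succ, Finset.sum_range_succ]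
      calc _ = ∑ t ∈ Finset.range n, (c t + k₁ t) + (c n + J (n + 1)) + k₁ n := by abel
        _ = (∑ t ∈ Finset.range n, (c t + k₁ t) + J n) + (d n + k₂ n) + k₁ n := by
          rw [e2]; abel
        _ = _ := by rw [e1]; abel
  rw [h.cost_eq_sum hinit hnoise hL hf₂ hcost hfinal]
  change ∑ t ∈ Finset.range M.T, (c t + k₁ t) + (∫⁻ ω, ENNReal.ofReal (M.terminalCost
    (M.augInfo L M.T (i M.T ω))) ∂P + k₃) = _
  rw [← hVT, ← add_assoc, hsum M.T le_rfl]
  abel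

/-- An almost surely linear feedback makes the states square integrable, so the estimate is the
conditional mean z_t. The restrictions of K_t to its two blocks are then the coefficients of î_t and
z_t. -/
theorem hasStructure2_of_feedback (hf₂ : ∀ t, Measurable (f₂ t))
    (K : ∀ t, M.AugState t →L[ℝ] (Fin (M.m₂ t) → ℝ))
    (hK : ∀ t < M.T, ∀ᵐ ω ∂P, f₂ t (M.info2 (M.linearStrategy1 G) f₂ x₀ w v t ω) =
      K t (M.augInfo L t (M.info2 (M.linearStrategy1 G) f₂ x₀ w v t ω))) :
    M.HasStructure2 (M.linearStrategy1 G) f₂ x₀ w v P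
      (fun t => LinearMap.toMatrix' (K t ∘L .inr ℝ _ _).toLinearMap)
      (fun t => LinearMap.toMatrix' (K t ∘L .inl ℝ _ _).toLinearMap) := by
  have hx : ∀ t ≤ M.T, Integrable (M.state (M.linearStrategy1 G) f₂ x₀ w v t) P := fun t ht =>
    (h.memLp_state_of_linear hinit hnoise (fun t => K t ∘L M.augInfo L t) hK ht).integrable
      one_le_two
  refine ⟨hx, fun t ht => ?_⟩
  filter_upwards [hK t ht, h.condMean_ae_eq_estimate hinit hnoise hL
    (M.measurable_linearStrategy1 G) hf₂ ht.le (hx t ht.le)] with ω h1 h2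
  rw [h1, h2, LinearMap.toMatrix'_mulVec, LinearMap.toMatrix'_mulVec]
  simp only [ContinuousLinearMap.coe_coe, ContinuousLinearMap.comp_apply]
  rw [← map_add]
  simp [augInfo, info1]

theorem exists_structure2 (hcost : ∀ t < M.T, (M.costWeight t).PosSemidef)
    (hfinal : M.P_final.PosSemidef) (G : ∀ t, Matrix (Fin (M.m₁ t)) (M.InfoIdx1 t) ℝ) :
    ∃ (H₁ : ∀ t, Matrix (Fin (M.m₂ t)) (M.InfoIdx1 t) ℝ)
      (H₂ : ∀ t, Matrix (Fin (M.m₂ t)) (M.StateIdx t) ℝ),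
      (∃ f₂ : M.Strategy2, M.IsOptimal2 (M.linearStrategy1 G) f₂ x₀ w v P ∧
        M.HasStructure2 (M.linearStrategy1 G) f₂ x₀ w v P H₁ H₂) ∧
      ((∀ t < M.T, (M.R t).PosDef) →
        ∀ f₂ : M.Strategy2, M.IsOptimal2 (M.linearStrategy1 G) f₂ x₀ w v P →
          M.HasStructure2 (M.linearStrategy1 G) f₂ x₀ w v P H₁ H₂) := by
  obtain ⟨K, δ, κ, hκ, hδ, hc⟩ := h.exists_cost_eq hinit hnoise hL hcost hfinal G
  let fopt : M.Strategy2 := fun t i => K t (M.augInfo L t i)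
  have hm : ∀ t, Measurable (fopt t) := fun t => (K t ∘L M.augInfo L t).measurable
  have hopt : M.cost (M.linearStrategy1 G) fopt x₀ w v P = κ := by
    rw [hc fopt hm, Finset.sum_eq_zero, add_zero]
    intro t ht
    simp [fopt, (hδ t (Finset.mem_range.1 ht)).1.map_zero]
  refine ⟨_, _, ⟨fopt, ⟨hm, fun g hg => ?_⟩, h.hasStructure2_of_feedback hinit hnoise hL hm K
    fun t _ => ae_of_all _ fun ω => rfl⟩, fun hR f₂ hf₂ =>
    h.hasStructure2_of_feedback hinit hnoise hL hf₂.1 K fun t ht => ?_⟩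
  · rw [hopt, hc g hg]
    exact le_self_add
  · have hle := hf₂.2 fopt hm
    rw [hopt, hc f₂ hf₂.1] at hle
    -- Finiteness of κ allows cancelling it, so an optimal strategy has zero total deviation cost,
    -- and each nonnegative term vanishes.
    have hzero := le_antisymm ((ENNReal.add_le_add_iff_left hκ).1 (hle.trans_eq (add_zero κ).symm))
      zero_le
    have ht0 := (Finset.sum_eq_zero_iff.1 hzero) t (Finset.mem_range.2 ht)
    have him := h.measurable_info2 (M.measurable_linearStrategy1 G) hf₂.1 t
    filter_upwards [(lintegral_eq_zero_iff ((hδ t ht).1.measurable_ofReal_comp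
      (((hf₂.1 t).comp him).sub ((K t ∘L M.augInfo L t).measurable.comp him)))).1 ht0] with ω hω
    rw [Pi.zero_apply, ENNReal.ofReal_eq_zero] at hω
    exact sub_eq_zero.1 (eq_zero_of_runningCost_nonpos (hR t ht)
      (((hδ t ht).2 _).trans hω))

end IsPrimitive

end TwoPlayerLQG

theorem mainTheorem3 (M : TwoPlayerLQG)
    (hinit : M.Sigma_init.PosSemidef)
    (hnoise : ∀ t < M.T, (M.noiseCov t).PosSemidef)
    (hcost : ∀ t < M.T, (M.costWeight t).PosSemidef)
    (hfinal : M.P_final.PosSemidef)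
    {Ω : Type*} [MeasurableSpace Ω] (P : Measure Ω) [IsProbabilityMeasure P]
    (x₀ : Ω → M.StateIdx 0 → ℝ) (w : ∀ t, Ω → M.StateIdx (t + 1) → ℝ)
    (v : ∀ t, Ω → M.MeasIdx t → ℝ) (hprim : M.IsPrimitive x₀ w v P) :
    (∀ G : ∀ t, Matrix (Fin (M.m₁ t)) (M.InfoIdx1 t) ℝ,
      ∃ (H₁ : ∀ t, Matrix (Fin (M.m₂ t)) (M.InfoIdx1 t) ℝ)
        (H₂ : ∀ t, Matrix (Fin (M.m₂ t)) (M.StateIdx t) ℝ),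
        (∃ f₂ : M.Strategy2, M.IsOptimal2 (M.linearStrategy1 G) f₂ x₀ w v P ∧
          M.HasStructure2 (M.linearStrategy1 G) f₂ x₀ w v P H₁ H₂) ∧
        ((∀ t < M.T, (M.R t).PosDef) →
          ∀ f₂ : M.Strategy2, M.IsOptimal2 (M.linearStrategy1 G) f₂ x₀ w v P →
            M.HasStructure2 (M.linearStrategy1 G) f₂ x₀ w v P H₁ H₂)) ∧
    ((∀ t < M.T, (M.C t * M.errCov t * (M.C t)ᵀ + M.V t).PosDef) →
      ∀ (f₁ : M.Strategy1) (f₂ : M.Strategy2),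
        (∀ t, Measurable (f₁ t)) → (∀ t, Measurable (f₂ t)) →
        (∀ t ≤ M.T, Integrable (M.state f₁ f₂ x₀ w v t) P) →
        (∀ᵐ ω ∂P, M.condMean f₁ f₂ x₀ w v P 0 ω = 0) ∧
        ∀ t < M.T, ∀ᵐ ω ∂P,
          M.condMean f₁ f₂ x₀ w v P (t + 1) ω =
            M.A t *ᵥ M.condMean f₁ f₂ x₀ w v P t ω + M.B t *ᵥ M.act f₁ f₂ x₀ w v t ω
              - M.kalmanGain t *ᵥ
                (M.meas f₁ f₂ x₀ w v t ω - M.C t *ᵥ M.condMean f₁ f₂ x₀ w v P t ω)) := by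
  refine ⟨fun G => ?_, fun hpos f₁ f₂ hf₁ hf₂ hx => ?_⟩
  -- Nothing is assumed invertible here: any gain solving the normal equations serves, and the
  -- conclusion mentions only conditional means.
  · obtain ⟨L, Sig, hL⟩ := M.exists_isFilterGain hinit hnoise
    exact hprim.exists_structure2 hinit hnoise hL hcost hfinal G
  · exact hprim.kalman_filter hinit hnoise (M.isFilterGain_kalmanGain hpos) hf₁ hf₂ hx
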